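/- Let $(X,d)$ be a non-empty metric space and let $A$ be a complex Banach algebra (not necessarily unital) with $\Delta(A)\neq\emptyset$, where $\Delta(A)$ is the set of non-zero continuous multiplicative linear functionals on $A$. Let $\mathrm{Lip}(X)$ be the Banach algebra of bounded Lipschitz functions $f:X\to\mathbb C$ with pointwise operations and the norm $\|f\|=\sup_{x}|f(x)|+\sup_{x\neq y}\frac{|f(x)-f(y)|}{d(x,y)}$, and let $\mathrm{lip}(X)$ be its closed subalgebra of all $f$ with $\lim_{r\to0}\sup\{|f(x)-f(y)|/d(x,y):0<d(x,y)<r\}=0$. Second duals carry the first Arens product, and $\check\otimes$ and $\hat\otimes$ denote the completed injective and projective tensor products, with the continuous multiplication extending $(F\otimes m)(F'\otimes m')=FF'\otimes mm'$. A Banach algebra $B$ is amenable if, for every Banach $B$-bimodule $E$, every continuous derivation $B\to E^*$ is inner. The space $X$ is uniformly discrete if there is $r>0$ with $d(x,y)>r$ for all $x\neq y$ in $X$. Then the following assertions are equivalent: (a) $\mathrm{Lip}(X)^{**}\check\otimes A^{**}$ is amenable; (b) $\mathrm{Lip}(X)^{**}\hat\otimes A^{**}$ is amenable; (c) $X$ is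 uniformly discrete and $A^{**}$ is amenable. If $\mathrm{lip}(X)$ separates the points of $X$, the same equivalence holds with $\mathrm{lip}(X)$ in place of $\mathrm{Lip}(X)$. Moreover, without this separation hypothesis, it remains true that $\mathrm{lip}(X)^{**}\check\otimes A^{**}$ is amenable if and only if $\mathrm{lip}(X)^{**}\hat\otimes A^{**}$ is amenable, that the amenability of $\mathrm{lip}(X)^{**}\check\otimes A^{**}$ implies that of $A^{**}$, and that (c) implies the amenability of $\mathrm{lip}(X)^{**}\check\otimes A^{**}$. -/

import Mathlib

open scoped TensorProduct

set_option maxSynthPendingDepth 3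

noncomputable section

namespace LipTensor

/-! ## Amenability

A Banach algebra is represented by a complex normed space `T` together with its (continuous,
bilinear) multiplication `m : T →L[ℂ] T →L[ℂ] T`. -/

section Amenability

universe u

variable {T : Type u} [NormedAddCommGroup T] [NormedSpace ℂ T]

/-- `L a x` is the left action `a · x` and `R a x` is the right action `x · a` of the algebra `T`
(with multiplication `m`) on `E`; both actions are bounded since `L` and `R` are continuous
bilinear maps. -/
structure IsBimodule (m : T →L[ℂ] T →L[ℂ] T) {E : Type*} [NormedAddCommGroup E] [NormedSpace ℂ E]
    (L R : T →L[ℂ] E →L[ℂ] E) : Prop where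
  left_mul : ∀ a b x, L (m a b) x = L a (L b x)
  right_mul : ∀ a b x, R (m a b) x = R b (R a x)
  left_right : ∀ a b x, R b (L a x) = L a (R b x)

/-- Amenability: for each Banach bimodule `E`, every continuous derivation `D : T → E*` is inner.
The dual `E*` carries the actions `(a · φ) x = φ (x · a)` and `(φ · a) x = φ (a · x)`, that is,
`a · φ = φ ∘ R a` and `φ · a = φ ∘ L a`. -/
def IsAmenable (m : T →L[ℂ] T →L[ℂ] T) : Prop :=
  ∀ (E : Type u) [NormedAddCommGroup E] [NormedSpace ℂ E] [CompleteSpace E]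
    (L R : T →L[ℂ] E →L[ℂ] E), IsBimodule m L R →
    ∀ D : T →L[ℂ] StrongDual ℂ E,
      (∀ a b, D (m a b) = (D a).comp (L b) + (D b).comp (R a)) →
      ∃ z : StrongDual ℂ E, ∀ a, D a = z.comp (R a) - z.comp (L a)

end Amenability

/-! ## Second duals and the first Arens product -/

section Arens

variable {E F G : Type*} [NormedAddCommGroup E] [NormedSpace ℂ E]
  [NormedAddCommGroup F] [NormedSpace ℂ F] [NormedAddCommGroup G] [NormedSpace ℂ G]

/-- The second dual `E**`. -/
abbrev Bidual (E : Type*) [NormedAddCommGroup E] [NormedSpace ℂ E] : Type _ :=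
  StrongDual ℂ (StrongDual ℂ E)

/-- The adjoint `G* × E → F*` of a bounded bilinear map `m : E × F → G`. -/
def bilinAdjoint (m : E →L[ℂ] F →L[ℂ] G) : StrongDual ℂ G →L[ℂ] E →L[ℂ] StrongDual ℂ F :=
  ((ContinuousLinearMap.compL ℂ E (F →L[ℂ] G) (StrongDual ℂ F)).flip m).comp
    (ContinuousLinearMap.compL ℂ F G ℂ)

theorem bilinAdjoint_apply (m : E →L[ℂ] F →L[ℂ] G) (l : StrongDual ℂ G) (x : E) (y : F) :
    bilinAdjoint m l x y = l (m x y) := rfl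

/-- The first Arens extension `E** × F** → G**` of a bounded bilinear map: the third adjoint. -/
def arens (m : E →L[ℂ] F →L[ℂ] G) : Bidual E →L[ℂ] Bidual F →L[ℂ] Bidual G :=
  bilinAdjoint (bilinAdjoint (bilinAdjoint m))

/-- `⟨Φ □ Ψ, l⟩ = ⟨Φ, Ψ · l⟩`, where `⟨Ψ · l, x⟩ = ⟨Ψ, l · x⟩` and `⟨l · x, y⟩ = ⟨l, x y⟩`. -/
theorem arens_apply (m : E →L[ℂ] F →L[ℂ] G) (Φ : Bidual E) (Ψ : Bidual F)
    (l : StrongDual ℂ G) :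
    arens m Φ Ψ l = Φ (bilinAdjoint (bilinAdjoint m) Ψ l) ∧
      ∀ x, bilinAdjoint (bilinAdjoint m) Ψ l x = Ψ (bilinAdjoint m l x) := ⟨rfl, fun _ => rfl⟩

/-- The multiplication (first Arens product) of the second dual of a Banach algebra. -/
def bidualMul (A : Type*) [NonUnitalNormedRing A] [NormedSpace ℂ A] [IsScalarTower ℂ A A]
    [SMulCommClass ℂ A A] : Bidual A →L[ℂ] Bidual A →L[ℂ] Bidual A :=
  arens (ContinuousLinearMap.mul ℂ A)

end Arens

/-! ## Completed tensor products -/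

section Completion

/-- The vector space `V`, topologized by the seminorm `p`. -/
def SeminormSpace {V : Type*} [AddCommGroup V] [Module ℂ V] (_p : Seminorm ℂ V) : Type _ := V

variable {V : Type*} [AddCommGroup V] [Module ℂ V] (p : Seminorm ℂ V)

instance : SeminormedAddCommGroup (SeminormSpace p) :=
  p.toAddGroupSeminorm.toSeminormedAddCommGroup

instance : Module ℂ (SeminormSpace p) := inferInstanceAs (Module ℂ V)

instance : NormedSpace ℂ (SeminormSpace p) where
  norm_smul_le c v := (map_smul_eq_mul p c v).le

/-- The Banach space completion of `V` for the seminorm `p`. -/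
abbrev SeminormCompletion : Type _ := UniformSpace.Completion (SeminormSpace p)

/-- The canonical map from `V` to its completion. -/
def toCompletion (v : V) : SeminormCompletion p :=
  UniformSpace.Completion.coe' (α := SeminormSpace p) v

end Completion

section Tensor

variable (E F : Type*) [NormedAddCommGroup E] [NormedSpace ℂ E]
  [NormedAddCommGroup F] [NormedSpace ℂ F]

/-- The values `∑ ‖xᵢ‖ ‖yᵢ‖` over all representations `u = ∑ xᵢ ⊗ yᵢ`. -/
def projValues (u : E ⊗[ℂ] F) : Set ℝ :=
  {s | ∃ l : List (E × F), (l.map fun q => q.1 ⊗ₜ[ℂ] q.2).sum = u ∧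
    s = (l.map fun q => ‖q.1‖ * ‖q.2‖).sum}

variable {E F}

theorem projValues_nonneg {u : E ⊗[ℂ] F} {s : ℝ} (hs : s ∈ projValues E F u) : 0 ≤ s := by
  obtain ⟨l, -, rfl⟩ := hs
  apply List.sum_nonneg
  intro x hx
  obtain ⟨q, -, rfl⟩ := List.mem_map.1 hx
  positivity

theorem projValues_bddBelow (u : E ⊗[ℂ] F) : BddBelow (projValues E F u) :=
  ⟨0, fun _ hs => projValues_nonneg hs⟩

theorem projValues_add {u v : E ⊗[ℂ] F} {s t : ℝ} (hs : s ∈ projValues E F u)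
    (ht : t ∈ projValues E F v) : s + t ∈ projValues E F (u + v) := by
  obtain ⟨l, rfl, rfl⟩ := hs
  obtain ⟨k, rfl, rfl⟩ := ht
  exact ⟨l ++ k, by simp, by simp⟩

theorem projValues_smul (c : ℂ) {u : E ⊗[ℂ] F} {s : ℝ} (hs : s ∈ projValues E F u) :
    ‖c‖ * s ∈ projValues E F (c • u) := by
  obtain ⟨l, rfl, rfl⟩ := hs
  refine ⟨l.map fun q => (c • q.1, q.2), ?_, ?_⟩
  · rw [List.smul_sum]
    simp [Function.comp_def, TensorProduct.smul_tmul']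
  · rw [← List.sum_map_mul_left]
    simp [Function.comp_def, norm_smul, mul_assoc]

theorem projValues_nonempty (u : E ⊗[ℂ] F) : (projValues E F u).Nonempty := by
  induction u using TensorProduct.induction_on with
  | zero => exact ⟨0, [], by simp, by simp⟩
  | tmul x y => exact ⟨‖x‖ * ‖y‖, [(x, y)], by simp, by simp⟩
  | add u v hu hv =>
    obtain ⟨s, hs⟩ := hu
    obtain ⟨t, ht⟩ := hv
    exact ⟨s + t, projValues_add hs ht⟩

variable (E F)

/-- The projective norm `‖u‖_π = inf {∑ ‖xᵢ‖ ‖yᵢ‖ : u = ∑ xᵢ ⊗ yᵢ}`. -/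
def projNorm : Seminorm ℂ (E ⊗[ℂ] F) :=
  Seminorm.ofSMulLE (fun u => sInf (projValues E F u))
    (le_antisymm (csInf_le (projValues_bddBelow 0) ⟨[], by simp, by simp⟩)
      (Real.sInf_nonneg fun _ hs => projValues_nonneg hs))
    (fun u v => by
      rw [← csInf_add (projValues_nonempty u) (projValues_bddBelow u)
        (projValues_nonempty v) (projValues_bddBelow v)]
      apply csInf_le_csInf (projValues_bddBelow _)
        ((projValues_nonempty u).add (projValues_nonempty v))
      rintro _ ⟨s, hs, t, ht, rfl⟩
      exact projValues_add hs ht)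
    (fun c u => by
      rw [← smul_eq_mul, ← Real.sInf_smul_of_nonneg (norm_nonneg c)]
      apply csInf_le_csInf (projValues_bddBelow _) ((projValues_nonempty u).smul_set)
      rintro _ ⟨s, hs, rfl⟩
      exact projValues_smul c hs)

/-- The tensor `∑ xᵢ ⊗ yᵢ`, viewed as the bounded bilinear form
`(φ, ψ) ↦ ∑ φ xᵢ * ψ yᵢ` on `E* × F*`. -/
def tensorForm : E ⊗[ℂ] F →ₗ[ℂ] (StrongDual ℂ E →L[ℂ] StrongDual ℂ F →L[ℂ] ℂ) :=
  TensorProduct.lift <| LinearMap.mk₂ ℂ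
    (fun x y => (NormedSpace.inclusionInDoubleDual ℂ E x).smulRight
      (NormedSpace.inclusionInDoubleDual ℂ F y))
    (fun x x' y => by ext; simp [add_mul])
    (fun c x y => by ext; simp [mul_assoc])
    (fun x y y' => by ext; simp)
    (fun c x y => by ext; simp [mul_left_comm])

theorem tensorForm_tmul (x : E) (y : F) (φ : StrongDual ℂ E) (ψ : StrongDual ℂ F) :
    tensorForm E F (x ⊗ₜ y) φ ψ = φ x * ψ y := by
  simp [tensorForm]

/-- The injective norm `‖u‖_ε = sup {|(φ ⊗ ψ) u| : ‖φ‖ ≤ 1, ‖ψ‖ ≤ 1}`, that is, the norm of `u`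
as a bilinear form on `E* × F*`. -/
def injNorm : Seminorm ℂ (E ⊗[ℂ] F) :=
  (normSeminorm ℂ (StrongDual ℂ E →L[ℂ] StrongDual ℂ F →L[ℂ] ℂ)).comp (tensorForm E F)

variable {E F}

/-- `m` is the multiplication of the completion of `E ⊗ F` for the seminorm `p`: the continuous
extension of `(x ⊗ y) (x' ⊗ y') = x x' ⊗ y y'`. -/
def IsTensorMul (p : Seminorm ℂ (E ⊗[ℂ] F)) (mE : E →L[ℂ] E →L[ℂ] E) (mF : F →L[ℂ] F →L[ℂ] F)
    (m : SeminormCompletion p →L[ℂ] SeminormCompletion p →L[ℂ] SeminormCompletion p) : Prop :=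
  ∀ x y x' y', m (toCompletion p (x ⊗ₜ y)) (toCompletion p (x' ⊗ₜ y')) =
    toCompletion p (mE x x' ⊗ₜ mF y y')

/-- By density there is at most one such multiplication. -/
theorem IsTensorMul.unique {p : Seminorm ℂ (E ⊗[ℂ] F)} {mE : E →L[ℂ] E →L[ℂ] E}
    {mF : F →L[ℂ] F →L[ℂ] F}
    {m m' : SeminormCompletion p →L[ℂ] SeminormCompletion p →L[ℂ] SeminormCompletion p}
    (h : IsTensorMul p mE mF m) (h' : IsTensorMul p mE mF m') : m = m' := by
  have hadd : ∀ u v : E ⊗[ℂ] F,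
      toCompletion p (u + v) = toCompletion p u + toCompletion p v := fun u v =>
    UniformSpace.Completion.coe_add (α := SeminormSpace p) u v
  have hzero : toCompletion p 0 = 0 := UniformSpace.Completion.coe_zero (α := SeminormSpace p)
  have key : ∀ u v : E ⊗[ℂ] F, m (toCompletion p u) (toCompletion p v) =
      m' (toCompletion p u) (toCompletion p v) := by
    intro u v
    induction u using TensorProduct.induction_on with
    | zero => simp [hzero]
    | add u u' hu hu' => simp [hadd, hu, hu']
    | tmul x y =>
      induction v using TensorProduct.induction_on with
      | zero => simp [hzero]
      | add v v' hv hv' => simp [hadd, hv, hv']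
      | tmul x' y' => rw [h, h']
  ext a b
  refine UniformSpace.Completion.induction_on₂ a b (isClosed_eq ?_ ?_) key
  · fun_prop
  · fun_prop

/-- The completion of `E ⊗ F` for the seminorm `p` is a Banach algebra (up to an equivalent norm)
for the multiplication of tensors, and this Banach algebra is amenable. -/
def IsAmenableTensor (p : Seminorm ℂ (E ⊗[ℂ] F)) (mE : E →L[ℂ] E →L[ℂ] E)
    (mF : F →L[ℂ] F →L[ℂ] F) : Prop :=
  ∃ m, IsTensorMul p mE mF m ∧ IsAmenable m

end Tensor

/-- The injective tensor product of the second duals of `B` and `A` is amenable. -/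
def InjTensorBidualAmenable (B A : Type*) [NonUnitalNormedRing B] [NormedSpace ℂ B]
    [IsScalarTower ℂ B B] [SMulCommClass ℂ B B] [NonUnitalNormedRing A] [NormedSpace ℂ A]
    [IsScalarTower ℂ A A] [SMulCommClass ℂ A A] : Prop :=
  IsAmenableTensor (injNorm (Bidual B) (Bidual A)) (bidualMul B) (bidualMul A)

/-- The projective tensor product of the second duals of `B` and `A` is amenable. -/
def ProjTensorBidualAmenable (B A : Type*) [NonUnitalNormedRing B] [NormedSpace ℂ B]
    [IsScalarTower ℂ B B] [SMulCommClass ℂ B B] [NonUnitalNormedRing A] [NormedSpace ℂ A]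
    [IsScalarTower ℂ A A] [SMulCommClass ℂ A A] : Prop :=
  IsAmenableTensor (projNorm (Bidual B) (Bidual A)) (bidualMul B) (bidualMul A)

/-! ## Lipschitz algebras -/

section Lipschitz

variable (X : Type*) [MetricSpace X]

/-- There is a positive lower bound for the distances of distinct points. -/
def UniformlyDiscrete : Prop := ∃ r : ℝ, 0 < r ∧ ∀ x y : X, x ≠ y → r < dist x y

/-- Bounded complex functions with bounded difference quotients. -/
def lipSubalgebra : Subalgebra ℂ (X → ℂ) where
  carrier := {f | (∃ C : ℝ, ∀ x, ‖f x‖ ≤ C) ∧ ∃ K : ℝ, ∀ x y, ‖f x - f y‖ ≤ K * dist x y}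
  mul_mem' := by
    rintro f g ⟨⟨C, hC⟩, K, hK⟩ ⟨⟨C', hC'⟩, K', hK'⟩
    refine ⟨⟨C * C', fun x => ?_⟩, C * K' + K * C', fun x y => ?_⟩
    · rw [Pi.mul_apply, norm_mul]
      exact mul_le_mul (hC x) (hC' x) (norm_nonneg _) ((norm_nonneg _).trans (hC x))
    · have h : (f * g) x - (f * g) y = f x * (g x - g y) + (f x - f y) * g y := by
        simp only [Pi.mul_apply]; ring
      rw [h]
      refine (norm_add_le _ _).trans ?_
      rw [norm_mul, norm_mul]
      have h1 := mul_le_mul (hC x) (hK' x y) (norm_nonneg _) ((norm_nonneg _).trans (hC x))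
      have h2 := mul_le_mul (hK x y) (hC' y) (norm_nonneg _) ((norm_nonneg _).trans (hK x y))
      linarith
  add_mem' := by
    rintro f g ⟨⟨C, hC⟩, K, hK⟩ ⟨⟨C', hC'⟩, K', hK'⟩
    refine ⟨⟨C + C', fun x => (norm_add_le _ _).trans (add_le_add (hC x) (hC' x))⟩,
      K + K', fun x y => ?_⟩
    have h : (f + g) x - (f + g) y = (f x - f y) + (g x - g y) := by
      simp only [Pi.add_apply]; ring
    rw [h, add_mul]
    exact (norm_add_le _ _).trans (add_le_add (hK x y) (hK' x y))
  algebraMap_mem' c := ⟨⟨‖c‖, fun x => by simp⟩, 0, fun x y => by simp⟩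

/-- The algebra `Lip(X)` of bounded Lipschitz functions `X → ℂ`, with pointwise operations. -/
def Lip : Type _ := lipSubalgebra X

namespace Lip

instance : CommRing (Lip X) := inferInstanceAs (CommRing (lipSubalgebra X))
instance : Algebra ℂ (Lip X) := inferInstanceAs (Algebra ℂ (lipSubalgebra X))

variable {X}

instance : CoeFun (Lip X) fun _ => X → ℂ := ⟨fun f => f.1⟩

theorem ext {f g : Lip X} (h : ∀ x, f x = g x) : f = g := Subtype.ext (funext h)

theorem add_apply (f g : Lip X) (x : X) : (f + g) x = f x + g x := rfl
theorem mul_apply (f g : Lip X) (x : X) : (f * g) x = f x * g x := rfl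
theorem neg_apply (f : Lip X) (x : X) : (-f) x = -f x := rfl
theorem zero_apply (x : X) : (0 : Lip X) x = 0 := rfl
theorem smul_apply (c : ℂ) (f : Lip X) (x : X) : (c • f) x = c * f x := rfl

/-- `‖f‖_∞ = sup |f x|`. -/
def supNorm (f : Lip X) : ℝ := ⨆ x, ‖f x‖

/-- `sup |f x - f y| / d(x, y)`; the diagonal contributes `0 / 0 = 0`. -/
def lipConst (f : Lip X) : ℝ := ⨆ q : X × X, ‖f q.1 - f q.2‖ / dist q.1 q.2

theorem norm_le_supNorm (f : Lip X) (x : X) : ‖f x‖ ≤ supNorm f := by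
  obtain ⟨C, hC⟩ := f.2.1
  exact le_ciSup (f := fun x => ‖f x‖) ⟨C, by rintro _ ⟨x, rfl⟩; exact hC x⟩ x

theorem supNorm_nonneg (f : Lip X) : 0 ≤ supNorm f := Real.iSup_nonneg fun _ => norm_nonneg _

theorem lipConst_nonneg (f : Lip X) : 0 ≤ lipConst f := Real.iSup_nonneg fun _ => by positivity

theorem norm_sub_le_lipConst (f : Lip X) (x y : X) : ‖f x - f y‖ ≤ lipConst f * dist x y := by
  rcases eq_or_ne x y with rfl | hxy
  · simp
  obtain ⟨K, hK⟩ := f.2.2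
  rw [← div_le_iff₀ (dist_pos.2 hxy)]
  refine le_ciSup (f := fun q : X × X => ‖f q.1 - f q.2‖ / dist q.1 q.2)
    ⟨max K 0, ?_⟩ (x, y)
  rintro _ ⟨⟨a, b⟩, rfl⟩
  rcases eq_or_ne a b with rfl | hab
  · simp
  · exact ((div_le_iff₀ (dist_pos.2 hab)).2 (hK a b)).trans (le_max_left _ _)

theorem supNorm_le {f : Lip X} {C : ℝ} (hC : 0 ≤ C) (h : ∀ x, ‖f x‖ ≤ C) : supNorm f ≤ C :=
  Real.iSup_le h hC

theorem lipConst_le {f : Lip X} {K : ℝ} (hK : 0 ≤ K) (h : ∀ x y, ‖f x - f y‖ ≤ K * dist x y) :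
    lipConst f ≤ K :=
  Real.iSup_le (fun q => div_le_of_le_mul₀ dist_nonneg hK (h q.1 q.2)) hK

/-- The Lipschitz norm `‖f‖ = ‖f‖_∞ + sup |f x - f y| / d(x, y)`. -/
def lipNorm : AddGroupNorm (Lip X) where
  toFun f := supNorm f + lipConst f
  map_zero' := by
    have h1 : supNorm (0 : Lip X) ≤ 0 := supNorm_le le_rfl fun x => by simp [zero_apply]
    have h2 : lipConst (0 : Lip X) ≤ 0 := lipConst_le le_rfl fun x y => by simp [zero_apply]
    linarith [supNorm_nonneg (0 : Lip X), lipConst_nonneg (0 : Lip X)]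
  add_le' f g := by
    have h1 : supNorm (f + g) ≤ supNorm f + supNorm g :=
      supNorm_le (add_nonneg (supNorm_nonneg f) (supNorm_nonneg g)) fun x =>
        (norm_add_le _ _).trans (add_le_add (norm_le_supNorm f x) (norm_le_supNorm g x))
    have h2 : lipConst (f + g) ≤ lipConst f + lipConst g :=
      lipConst_le (add_nonneg (lipConst_nonneg f) (lipConst_nonneg g)) fun x y => by
        rw [add_apply, add_apply, add_sub_add_comm, add_mul]
        exact (norm_add_le _ _).trans
          (add_le_add (norm_sub_le_lipConst f x y) (norm_sub_le_lipConst g x y))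
    linarith
  neg' f := by
    have h1 : supNorm (-f) = supNorm f := by simp [supNorm, neg_apply]
    have h2 : lipConst (-f) = lipConst f := by
      simp only [lipConst, neg_apply, neg_sub_neg, norm_sub_rev]
    rw [h1, h2]
  eq_zero_of_map_eq_zero' f h := by
    have h0 : supNorm f = 0 := by linarith [supNorm_nonneg f, lipConst_nonneg f]
    exact ext fun x => norm_le_zero_iff.1 ((norm_le_supNorm f x).trans h0.le)

instance : NormedAddCommGroup (Lip X) := lipNorm.toNormedAddCommGroup

theorem norm_def (f : Lip X) : ‖f‖ = supNorm f + lipConst f := rfl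

theorem norm_mul_le' (f g : Lip X) : ‖f * g‖ ≤ ‖f‖ * ‖g‖ := by
  have f0 := supNorm_nonneg f
  have g0 := supNorm_nonneg g
  have f1 := lipConst_nonneg f
  have g1 := lipConst_nonneg g
  have h1 : supNorm (f * g) ≤ supNorm f * supNorm g :=
    supNorm_le (by positivity) fun x => by
      rw [mul_apply, norm_mul]
      exact mul_le_mul (norm_le_supNorm f x) (norm_le_supNorm g x) (norm_nonneg _) f0
  have h2 : lipConst (f * g) ≤ supNorm f * lipConst g + lipConst f * supNorm g :=
    lipConst_le (by positivity) fun x y => by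
      have h : (f * g) x - (f * g) y = f x * (g x - g y) + (f x - f y) * g y := by
        rw [mul_apply, mul_apply]; ring
      rw [h]
      refine (norm_add_le _ _).trans ?_
      rw [norm_mul, norm_mul]
      have a := mul_le_mul (norm_le_supNorm f x) (norm_sub_le_lipConst g x y) (norm_nonneg _) f0
      have b := mul_le_mul (norm_sub_le_lipConst f x y) (norm_le_supNorm g y) (norm_nonneg _)
        ((norm_nonneg _).trans (norm_sub_le_lipConst f x y))
      linarith
  rw [norm_def, norm_def, norm_def]
  nlinarith [mul_nonneg f1 g1]

instance : NormedCommRing (Lip X) :=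
  { (inferInstance : NormedAddCommGroup (Lip X)), (inferInstance : CommRing (Lip X)) with
    norm_mul_le := norm_mul_le' }

instance : NormedAlgebra ℂ (Lip X) where
  norm_smul_le c f := by
    have h1 : supNorm (c • f) ≤ ‖c‖ * supNorm f :=
      supNorm_le (mul_nonneg (norm_nonneg _) (supNorm_nonneg f)) fun x => by
        rw [smul_apply, norm_mul]
        exact mul_le_mul_of_nonneg_left (norm_le_supNorm f x) (norm_nonneg _)
    have h2 : lipConst (c • f) ≤ ‖c‖ * lipConst f :=
      lipConst_le (mul_nonneg (norm_nonneg _) (lipConst_nonneg f)) fun x y => by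
        rw [smul_apply, smul_apply, ← mul_sub, norm_mul, mul_assoc]
        exact mul_le_mul_of_nonneg_left (norm_sub_le_lipConst f x y) (norm_nonneg _)
    rw [norm_def, norm_def, mul_add]
    exact add_le_add h1 h2

end Lip

/-- The algebra `lip(X)` of little Lipschitz functions: those `f` in `Lip(X)` for which
`sup {|f x - f y| / d(x, y) : 0 < d(x, y) < r}` tends to `0` as `r → 0`. It carries the norm of
`Lip(X)`. -/
def littleLip : Subalgebra ℂ (Lip X) where
  carrier := {f | ∀ ε : ℝ, 0 < ε → ∃ r : ℝ, 0 < r ∧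
    ∀ x y, 0 < dist x y → dist x y < r → ‖f x - f y‖ / dist x y ≤ ε}
  mul_mem' := by
    intro f g hf hg ε hε
    have f0 := Lip.supNorm_nonneg f
    have g0 := Lip.supNorm_nonneg g
    set M := Lip.supNorm f + Lip.supNorm g + 1 with hM
    have hM0 : 0 < M := by positivity
    obtain ⟨r, hr, h⟩ := hf (ε / M) (by positivity)
    obtain ⟨s, hs, k⟩ := hg (ε / M) (by positivity)
    refine ⟨min r s, lt_min hr hs, fun x y hxy hlt => ?_⟩
    have a := (div_le_iff₀ hxy).1 (h x y hxy (hlt.trans_le (min_le_left _ _)))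
    have b := (div_le_iff₀ hxy).1 (k x y hxy (hlt.trans_le (min_le_right _ _)))
    rw [div_le_iff₀ hxy]
    have e : (f * g) x - (f * g) y = f x * (g x - g y) + (f x - f y) * g y := by
      rw [Lip.mul_apply, Lip.mul_apply]; ring
    have hδ : 0 ≤ ε / M * dist x y := by positivity
    rw [e]
    calc ‖f x * (g x - g y) + (f x - f y) * g y‖
        ≤ ‖f x‖ * ‖g x - g y‖ + ‖f x - f y‖ * ‖g y‖ := by
          rw [← norm_mul, ← norm_mul]; exact norm_add_le _ _
      _ ≤ Lip.supNorm f * (ε / M * dist x y) + ε / M * dist x y * Lip.supNorm g :=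
          add_le_add (mul_le_mul (Lip.norm_le_supNorm f x) b (norm_nonneg _) f0)
            (mul_le_mul a (Lip.norm_le_supNorm g y) (norm_nonneg _) hδ)
      _ ≤ M * (ε / M * dist x y) := by rw [hM]; linarith
      _ = ε * dist x y := by field_simp
  add_mem' := by
    intro f g hf hg ε hε
    obtain ⟨r, hr, h⟩ := hf (ε / 2) (by positivity)
    obtain ⟨s, hs, k⟩ := hg (ε / 2) (by positivity)
    refine ⟨min r s, lt_min hr hs, fun x y hxy hlt => ?_⟩
    have a := (div_le_iff₀ hxy).1 (h x y hxy (hlt.trans_le (min_le_left _ _)))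
    have b := (div_le_iff₀ hxy).1 (k x y hxy (hlt.trans_le (min_le_right _ _)))
    rw [div_le_iff₀ hxy, Lip.add_apply, Lip.add_apply, add_sub_add_comm]
    refine (norm_add_le _ _).trans ?_
    linarith
  algebraMap_mem' c := by
    intro ε hε
    refine ⟨1, one_pos, fun x y _ _ => ?_⟩
    have e : (algebraMap ℂ (Lip X) c) x - (algebraMap ℂ (Lip X) c) y = 0 := sub_self c
    rw [e]
    simpa using hε.le

/-- `lip(X)` separates the points of `X`. -/
def LittleLipSeparates : Prop := ∀ x y : X, x ≠ y → ∃ f ∈ littleLip X, f x ≠ f y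

end Lipschitz

end LipTensor

end

open scoped TensorProduct

set_option maxSynthPendingDepth 3

noncomputable section

namespace LipTensor

/-! ## Virtual diagonals -/

section VirtualDiagonal

universe u v

variable {T : Type u} [NormedAddCommGroup T] [NormedSpace ℂ T]

/-! Amenability is traded for a virtual diagonal, a functional `Q` on bounded bilinear forms
(`IsAmenable.exists_virtualDiagonal`, `IsVirtualDiagonal.isAmenable`). Virtual diagonals push
forward along bounded homomorphisms with dense range (`IsVirtualDiagonal.map`), and those of two
algebras combine to one of a completed tensor product (`IsVirtualDiagonal.tensor`).

Necessity. Slicing at a point evaluation maps the tensor product homomorphically onto `A**`, so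
`A**` inherits a virtual diagonal. Composing such slices with a character of `A` gives characters of
the tensor product. A virtual diagonal sends `χ₁ ⊗ χ₁` to `1` and `χ₁ ⊗ χ₂` to `0`, so distinct
characters cannot be close in norm (`IsVirtualDiagonal.one_le_norm_sub`). Evaluations at `x` and `y`
differ in norm by at most `dist x y`, hence points separated by the Lipschitz algebra are uniformly
apart. Only boundedness of slices is needed, so one argument serves both tensor norms.

Sufficiency. If separated points are uniformly apart, every bounded function that respects
non-separation lies in the Lipschitz algebra, which is then isomorphic to the bounded functions on a
discrete space. The second dual of the latter is a commutative unital C⋆-algebra: for a functional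
`l` of norm one, the form `l (x * y)` factors through a Hilbert space built from a state dominating
`l`, and reflexivity of that space yields commutativity of the Arens product and the C⋆-identity. A
commutative unital C⋆-algebra has a virtual diagonal because evaluation at `(1, 1)` can be made
invariant under the commutative unitary group (a Hahn–Banach form of Markov–Kakutani). By Gelfand
theory its characters are norming, which makes the injective norm submultiplicative up to a
constant, so that the injective tensor product is an algebra at all.

All points are separated by `Lip(X)`, and the condition becomes uniform discreteness. For `lip(X)`
it is `LittleLipDiscrete`, which is the same for both tensor norms and follows from uniform
discreteness; this gives the assertions without the separation hypothesis. -/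

/-- A virtual diagonal for the algebra `(T, m)`: an element of the second dual of the projective
tensor square of `T`, viewed as a functional on the bounded bilinear forms on `T`. -/
structure IsVirtualDiagonal (m : T →L[ℂ] T →L[ℂ] T) (Q : StrongDual ℂ (T →L[ℂ] T →L[ℂ] ℂ)) :
    Prop where
  balanced : ∀ a (β β₁ β₂ : T →L[ℂ] T →L[ℂ] ℂ), (∀ x y, β₁ x y = β (m a x) y) →
    (∀ x y, β₂ x y = β x (m y a)) → Q β₁ = Q β₂
  right_unit : ∀ a (l : StrongDual ℂ T) (β : T →L[ℂ] T →L[ℂ] ℂ),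
    (∀ x y, β x y = l (m (m x y) a)) → Q β = l a

/-- Balancing moves `a` from the far left of the product `a x y` to its far right, where
`right_unit` applies. -/
theorem IsVirtualDiagonal.left_unit {m : T →L[ℂ] T →L[ℂ] T}
    {Q : StrongDual ℂ (T →L[ℂ] T →L[ℂ] ℂ)} (hQ : IsVirtualDiagonal m Q)
    (hm : ∀ a b c, m (m a b) c = m a (m b c)) (a : T) (l : StrongDual ℂ T)
    (β : T →L[ℂ] T →L[ℂ] ℂ) (h : ∀ x y, β x y = l (m a (m x y))) : Q β = l a := by
  rw [hQ.balanced a (bilinAdjoint m l) β ((bilinAdjoint m l).bilinearComp (.id ℂ T) (m.flip a))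
    (fun x y => by rw [h, bilinAdjoint_apply, hm]) (fun x y => by simp)]
  exact hQ.right_unit a l _ fun x y => by simp [bilinAdjoint_apply, hm]

/-- The bounded bilinear action `(a, f) ↦ f ∘ m a` on linear maps `f : T → G`. -/
def precompAction {G : Type*} [NormedAddCommGroup G] [NormedSpace ℂ G]
    (m : T →L[ℂ] T →L[ℂ] T) : T →L[ℂ] (T →L[ℂ] G) →L[ℂ] (T →L[ℂ] G) :=
  (ContinuousLinearMap.compL ℂ T T G).flip ∘L m

@[simp] theorem precompAction_apply {G : Type*} [NormedAddCommGroup G] [NormedSpace ℂ G]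
    (m : T →L[ℂ] T →L[ℂ] T) (a : T) (f : T →L[ℂ] G) (x : T) :
    precompAction m a f x = f (m a x) := rfl

/-- The bounded bilinear action of `T` on bilinear forms that takes `(a, β)` to
`(x, y) ↦ β x (m y a)`. -/
def rightAction (m : T →L[ℂ] T →L[ℂ] T) :
    T →L[ℂ] (T →L[ℂ] T →L[ℂ] ℂ) →L[ℂ] (T →L[ℂ] T →L[ℂ] ℂ) :=
  (ContinuousLinearMap.compL ℂ T (T →L[ℂ] ℂ) (T →L[ℂ] ℂ)) ∘L precompAction m.flip

@[simp] theorem rightAction_apply (m : T →L[ℂ] T →L[ℂ] T) (a : T) (β : T →L[ℂ] T →L[ℂ] ℂ)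
    (x y : T) : rightAction m a β x y = β x (m y a) := rfl

/-- The bilinear form `(x, y) ↦ l (m (m x y) a)`. -/
def productForm (m : T →L[ℂ] T →L[ℂ] T) (l : StrongDual ℂ T) :
    T →L[ℂ] T →L[ℂ] T →L[ℂ] ℂ :=
  bilinAdjoint m ∘L (ContinuousLinearMap.compL ℂ T T ℂ l) ∘L m.flip

@[simp] theorem productForm_apply (m : T →L[ℂ] T →L[ℂ] T) (l : StrongDual ℂ T) (a x y : T) :
    productForm m l a x y = l (m (m x y) a) := rfl

/-- The conditions on a virtual diagonal need only be checked on a total subset. -/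
theorem IsVirtualDiagonal.of_total {m : T →L[ℂ] T →L[ℂ] T}
    {Q : StrongDual ℂ (T →L[ℂ] T →L[ℂ] ℂ)} {s : Set T}
    (hs : Dense (Submodule.span ℂ s : Set T))
    (hb : ∀ a ∈ s, ∀ β, Q (precompAction m a β) = Q (rightAction m a β))
    (hu : ∀ a ∈ s, ∀ l, Q (productForm m l a) = l a) : IsVirtualDiagonal m Q where
  balanced a β β₁ β₂ h₁ h₂ := by
    obtain rfl : β₁ = precompAction m a β := by ext x y; rw [h₁]; rfl
    obtain rfl : β₂ = rightAction m a β := by ext x y; rw [h₂]; rfl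
    have : Q ∘L (precompAction m).flip β = Q ∘L (rightAction m).flip β :=
      ContinuousLinearMap.ext_on hs fun a ha => hb a ha β
    exact DFunLike.congr_fun this a
  right_unit a l β h := by
    obtain rfl : β = productForm m l a := by ext x y; rw [h]; rfl
    have : Q ∘L productForm m l = l := ContinuousLinearMap.ext_on hs fun a ha => hu a ha l
    exact DFunLike.congr_fun this a

/-- A derivation into the dual of a bimodule that vanishes on a sub-bimodule is implemented by a
functional vanishing on this sub-bimodule. -/
theorem IsAmenable.exists_inner_vanishing {m : T →L[ℂ] T →L[ℂ] T} (hT : IsAmenable m)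
    {V : Type u} [NormedAddCommGroup V] [NormedSpace ℂ V] [CompleteSpace V]
    (L R : T →L[ℂ] V →L[ℂ] V) (hLR : IsBimodule m L R) (W : Submodule ℂ V)
    (hL : ∀ a, ∀ w ∈ W, L a w ∈ W) (hR : ∀ a, ∀ w ∈ W, R a w ∈ W)
    (D : T →L[ℂ] StrongDual ℂ V)
    (hD : ∀ a b, D (m a b) = (D a).comp (L b) + (D b).comp (R a))
    (hW : ∀ a, ∀ w ∈ W, D a w = 0) :
    ∃ z : StrongDual ℂ V, (∀ w ∈ W, z w = 0) ∧ ∀ a v, D a v = z (R a v) - z (L a v) := by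
  -- Amenability speaks of Banach bimodules only, so the quotient is taken by the closure;
  -- invariance of `W` and vanishing of `D` pass to it by continuity.
  set K := W.topologicalClosure with hK
  have : IsClosed (K : Set V) := W.isClosed_topologicalClosure
  have hclos : ∀ f : V →L[ℂ] V, (∀ w ∈ W, f w ∈ W) → ∀ w ∈ K, f w ∈ K := fun f hf w hw =>
    map_mem_closure f.continuous hw hf
  have hDK : ∀ w ∈ K, D.flip w = 0 := by
    intro w hw
    have : W.topologicalClosure ≤ D.flip.ker :=
      W.topologicalClosure_minimal (fun w hw => by ext a; exact hW a w hw)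
        D.flip.isClosed_ker
    exact this hw
  let act (S : T →L[ℂ] V →L[ℂ] V) : V →L[ℂ] T →L[ℂ] V ⧸ K :=
    (ContinuousLinearMap.compL ℂ T V (V ⧸ K) K.mkQL) ∘L S.flip
  have hact : ∀ S : T →L[ℂ] V →L[ℂ] V, (∀ a, ∀ w ∈ W, S a w ∈ W) → K ≤ (act S).ker := by
    intro S hS w hw
    ext a
    exact (Submodule.Quotient.mk_eq_zero K).2 (hclos (S a) (hS a) w hw)
  obtain ⟨z, hz⟩ := hT (V ⧸ K) (K.liftQL (act L) (hact L hL)).flip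
    (K.liftQL (act R) (hact R hR)).flip
    ⟨fun a b x => by
        induction x using Submodule.Quotient.induction_on with
        | H x => exact congrArg (Submodule.Quotient.mk (p := K)) (hLR.left_mul a b x),
      fun a b x => by
        induction x using Submodule.Quotient.induction_on with
        | H x => exact congrArg (Submodule.Quotient.mk (p := K)) (hLR.right_mul a b x),
      fun a b x => by
        induction x using Submodule.Quotient.induction_on with
        | H x => exact congrArg (Submodule.Quotient.mk (p := K)) (hLR.left_right a b x)⟩
    (K.liftQL D.flip hDK).flip
    (fun a b => by
      ext x
      induction x using Submodule.Quotient.induction_on with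
      | H x => exact DFunLike.congr_fun (hD a b) x)
  refine ⟨z ∘L K.mkQL, fun w hw => ?_, fun a v => ?_⟩
  · have : K.mkQL w = 0 := (Submodule.Quotient.mk_eq_zero K).2 (W.le_topologicalClosure hw)
    simp [this]
  · exact DFunLike.congr_fun (hz a) (K.mkQL v)

/-- The second dual of an amenable algebra contains a two-sided approximate unit. -/
theorem IsAmenable.exists_unit {m : T →L[ℂ] T →L[ℂ] T} (hT : IsAmenable m)
    (hm : ∀ a b c, m (m a b) c = m a (m b c)) :
    ∃ N : Bidual T, (∀ a (l : StrongDual ℂ T), N (l ∘L m.flip a) = l a) ∧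
      ∀ a (l : StrongDual ℂ T), N (l ∘L m a) = l a := by
  -- With one action zero, the canonical embedding into the second dual is a derivation. A
  -- functional implementing it is, up to sign, a one-sided unit.
  obtain ⟨w, -, hw⟩ := hT.exists_inner_vanishing (V := StrongDual ℂ T)
    (precompAction m.flip) 0 ⟨fun a b l => by ext; simp [hm], by simp, by simp⟩ ⊥
    (by simp) (by simp) (NormedSpace.inclusionInDoubleDual ℂ T)
    (fun a b => by ext; simp) (by simp)
  have hw' : ∀ a (l : StrongDual ℂ T), w (l ∘L m.flip a) = - l a := by
    intro a l
    have := hw a l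
    simp only [NormedSpace.dual_def, _root_.zero_apply, map_zero, zero_sub] at this
    rw [this, neg_neg]
    rfl
  -- `D` measures how far `-w` is from being a unit on the other side. It vanishes on the
  -- functionals `x ↦ l' (x a)`, so the correction `n` may be chosen to vanish there too, and `n -
  -- w` keeps the property already obtained.
  let D : T →L[ℂ] Bidual T := NormedSpace.inclusionInDoubleDual ℂ T +
    (ContinuousLinearMap.compL ℂ _ _ ℂ w) ∘L precompAction m
  have hDa : ∀ a (l : StrongDual ℂ T), D a l = l a + w (l ∘L m a) := fun a l => rfl
  obtain ⟨n, hn, hnD⟩ := hT.exists_inner_vanishing (V := StrongDual ℂ T) 0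
    (precompAction m) ⟨by simp, fun a b l => by ext; simp [hm], by simp⟩
    (Submodule.span ℂ {l | ∃ (l' : StrongDual ℂ T) (a : T), l = l' ∘L m.flip a})
    (by simp)
    (fun c l hl => by
      induction hl using Submodule.span_induction with
      | zero => simp
      | add x y _ _ hx hy => rw [map_add]; exact add_mem hx hy
      | smul r x _ hx => rw [map_smul]; exact Submodule.smul_mem _ _ hx
      | mem x hx =>
        obtain ⟨l', a, rfl⟩ := hx
        exact Submodule.subset_span ⟨l' ∘L m c, a, by ext; simp [hm]⟩)
    D (fun a b => by
      ext l
      have : l ∘L m (m a b) = (l ∘L m a) ∘L m b := by ext; simp [hm]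
      rw [hDa, this]
      simp [hDa]
      rfl)
    (fun a l hl => by
      induction hl using Submodule.span_induction with
      | zero => simp
      | add x y _ _ hx hy => rw [map_add, hx, hy, add_zero]
      | smul r x _ hx => rw [map_smul, hx, smul_zero]
      | mem x hx =>
        obtain ⟨l', b, rfl⟩ := hx
        have : (l' ∘L m.flip b) ∘L m a = (l' ∘L m a) ∘L m.flip b := by ext; simp [hm]
        rw [hDa, this, hw']
        simp)
  refine ⟨n - w, fun a l => ?_, fun a l => ?_⟩
  · rw [_root_.sub_apply, hw', hn _ (Submodule.subset_span ⟨l, a, rfl⟩)]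
    ring
  · have := hnD a l
    rw [hDa] at this
    simp only [_root_.zero_apply, map_zero, sub_zero] at this
    rw [_root_.sub_apply, sub_eq_iff_eq_add, this]
    rfl

/-- An amenable algebra has a virtual diagonal. -/
theorem IsAmenable.exists_virtualDiagonal {m : T →L[ℂ] T →L[ℂ] T} (hT : IsAmenable m)
    (hm : ∀ a b c, m (m a b) c = m a (m b c)) : ∃ Q, IsVirtualDiagonal m Q := by
  obtain ⟨N, hN₁, hN₂⟩ := hT.exists_unit hm
  let R : T →L[ℂ] (T →L[ℂ] T →L[ℂ] ℂ) →L[ℂ] (T →L[ℂ] T →L[ℂ] ℂ) := precompAction m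
  let L : T →L[ℂ] (T →L[ℂ] T →L[ℂ] ℂ) →L[ℂ] (T →L[ℂ] T →L[ℂ] ℂ) := rightAction m
  have hRa : ∀ a β x y, R a β x y = β (m a x) y := fun a β x y => rfl
  have hLa : ∀ a β x y, L a β x y = β x (m y a) := fun a β x y => rfl
  -- `M` is `N ⊗ N`: it has the right values on the forms `l (x y)` but need not be balanced.
  let M : StrongDual ℂ (T →L[ℂ] T →L[ℂ] ℂ) :=
    N ∘L (ContinuousLinearMap.compL ℂ T (T →L[ℂ] ℂ) ℂ N)
  have hMR : ∀ a l, M (R a (bilinAdjoint m l)) = l a := by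
    intro a l
    rw [← hN₂ a l]
    refine congrArg N ?_
    ext x
    refine Eq.trans ?_ (hN₂ (m a x) l)
    rfl
  have hML : ∀ a l, M (L a (bilinAdjoint m l)) = l a := by
    intro a l
    rw [← hN₁ a l]
    refine congrArg N ?_
    ext x
    refine Eq.trans ?_ (hN₁ a (l ∘L m x))
    rfl
  -- The defect of balance of `M`, an inner derivation. It vanishes on the forms `l (x y)`, so it is
  -- also implemented by some `z` that is zero on these forms; then `M - z` is balanced and has the
  -- same values on them as `M`.
  let D : T →L[ℂ] StrongDual ℂ (T →L[ℂ] T →L[ℂ] ℂ) :=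
    (ContinuousLinearMap.compL ℂ _ _ ℂ M) ∘L R - (ContinuousLinearMap.compL ℂ _ _ ℂ M) ∘L L
  have hDa : ∀ a β, D a β = M (R a β) - M (L a β) := fun a β => rfl
  have hRm : ∀ a b β, R (m a b) β = R b (R a β) := fun a b β => by
    ext x y; simp only [hRa, hm]
  have hLm : ∀ a b β, L (m a b) β = L a (L b β) := fun a b β => by
    ext x y; simp only [hLa, hm]
  have hLR : ∀ a b β, R b (L a β) = L a (R b β) := fun a b β => rfl
  obtain ⟨z, hzW, hz⟩ := hT.exists_inner_vanishing L R ⟨hLm, hRm, hLR⟩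
    (LinearMap.range (bilinAdjoint m).toLinearMap)
    (by
      rintro a _ ⟨l, rfl⟩
      exact ⟨l ∘L m.flip a, by ext x y; simp [hLa, bilinAdjoint_apply, hm]⟩)
    (by
      rintro a _ ⟨l, rfl⟩
      exact ⟨l ∘L m a, by ext x y; simp [hRa, bilinAdjoint_apply, hm]⟩)
    D
    (fun a b => by
      ext β
      simp only [hDa, _root_.add_apply, ContinuousLinearMap.comp_apply, hRm, hLm,
        hLR]
      ring)
    (by
      rintro a _ ⟨l, rfl⟩
      rw [ContinuousLinearMap.coe_coe, hDa, hMR, hML, sub_self])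
  refine ⟨M - z, ⟨fun a β β₁ β₂ h₁ h₂ => ?_, fun a l β h => ?_⟩⟩
  · obtain rfl : β₁ = R a β := by ext x y; rw [h₁, hRa]
    obtain rfl : β₂ = L a β := by ext x y; rw [h₂, hLa]
    have := hz a β
    rw [hDa] at this
    simp only [_root_.sub_apply]
    linear_combination this
  · have e₁ : β = L a (bilinAdjoint m l) := by
      ext x y; rw [h, hLa, bilinAdjoint_apply, hm]
    have e₂ : β = bilinAdjoint m (l ∘L m.flip a) := by
      ext x y; rw [h, bilinAdjoint_apply]; rfl
    rw [_root_.sub_apply, e₁, hML, ← e₁, e₂, hzW (bilinAdjoint m (l ∘L m.flip a)) ⟨_, rfl⟩,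
      sub_zero]

/-- An algebra with a virtual diagonal is amenable. -/
theorem IsVirtualDiagonal.isAmenable {m : T →L[ℂ] T →L[ℂ] T}
    {Q : StrongDual ℂ (T →L[ℂ] T →L[ℂ] ℂ)} (hQ : IsVirtualDiagonal m Q)
    (hm : ∀ a b c, m (m a b) c = m a (m b c)) : IsAmenable m := by
  intro E _ _ _ L R hLR D hD
  have hD' : ∀ a b e, D (m a b) e = D a (L b e) + D b (R a e) := fun a b e => by rw [hD]; rfl
  let form : E →L[ℂ] T →L[ℂ] T →L[ℂ] ℂ := (ContinuousLinearMap.compL ℂ T E (T →L[ℂ] ℂ) D.flip) ∘L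
    R.flip
  have hform : ∀ e x y, form e x y = D y (R x e) := fun e x y => rfl
  -- The usual averaging of `D`. By `hz` below it implements `D` up to replacing `D a e` by the
  -- average of `D a (R (x y) e)`.
  let z : StrongDual ℂ E := Q ∘L form
  let avg (a : T) (e : E) : T →L[ℂ] T →L[ℂ] ℂ := bilinAdjoint m (D a ∘L R.flip e)
  have havg : ∀ a e x y, avg a e x y = D a (R (m x y) e) := fun a e x y => rfl
  have hz : ∀ a e, z (R a e) = z (L a e) + Q (avg a e) := by
    intro a e
    change Q (form (R a e)) = Q (form (L a e)) + Q (avg a e)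
    rw [← map_add]
    refine hQ.balanced a (form e) _ _ (fun x y => ?_) (fun x y => ?_)
    · rw [hform, hform, hLR.right_mul]
    · rw [_root_.add_apply, _root_.add_apply, hform, hform, havg, hD',
        hLR.right_mul, hLR.left_right]
  -- The remainder after subtracting the inner derivation of `z`. It need not be zero when the
  -- module is not essential, but it vanishes on all `R b e`, so it is a derivation for a module
  -- with one trivial action.
  let D₁ : T →L[ℂ] StrongDual ℂ E := D - (ContinuousLinearMap.compL ℂ E E ℂ z) ∘L R +
    (ContinuousLinearMap.compL ℂ E E ℂ z) ∘L L
  have hD₁ : ∀ a e, D₁ a e = D a e - z (R a e) + z (L a e) := fun a e => rfl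
  have hD₁R : ∀ a b e, D₁ a (R b e) = 0 := by
    intro a b e
    have : Q (avg a (R b e)) = D a (R b e) :=
      hQ.left_unit hm b (D a ∘L R.flip e) _ fun x y => by
        rw [havg, ← hLR.right_mul]; rfl
    rw [hD₁, hz, this]
    ring
  have hD₁m : ∀ a b e, D₁ (m a b) e = D₁ a (L b e) := by
    intro a b e
    have h := hD₁R b a e
    simp only [hD₁, hD', hLR.right_mul, hLR.left_mul, hLR.left_right] at h ⊢
    linear_combination h
  -- The average of `D₁ (x y)`, with a sign: since `D₁ (m a b) = D₁ a ∘ L b`, this implements `D₁`.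
  let z₁ : StrongDual ℂ E := -(Q ∘L bilinAdjoint m ∘L D₁.flip)
  have hz₁ : ∀ e, z₁ e = -Q (bilinAdjoint m (D₁.flip e)) := fun e => rfl
  have hz₁R : ∀ a e, z₁ (R a e) = 0 := by
    intro a e
    have : D₁.flip (R a e) = 0 := by ext c; exact hD₁R c a e
    rw [hz₁, this, map_zero, map_zero, neg_zero]
  have hz₁L : ∀ a e, z₁ (L a e) = - D₁ a e := by
    intro a e
    rw [hz₁]
    refine congrArg Neg.neg (hQ.right_unit a (D₁.flip e) _ fun x y => ?_)
    rw [bilinAdjoint_apply, ContinuousLinearMap.flip_apply, ContinuousLinearMap.flip_apply, hD₁m, hD₁m,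
      hD₁m]
  refine ⟨z + z₁, fun a => ?_⟩
  ext e
  simp only [_root_.sub_apply, ContinuousLinearMap.comp_apply,
    _root_.add_apply, hz₁R, hz₁L, hD₁]
  ring

/-- Virtual diagonals are transported along bounded homomorphisms with dense range. -/
theorem IsVirtualDiagonal.map {S : Type v} [NormedAddCommGroup S] [NormedSpace ℂ S]
    {m : T →L[ℂ] T →L[ℂ] T} {Q : StrongDual ℂ (T →L[ℂ] T →L[ℂ] ℂ)} (hQ : IsVirtualDiagonal m Q)
    {mS : S →L[ℂ] S →L[ℂ] S} (θ : T →L[ℂ] S) (hθ : ∀ a b, θ (m a b) = mS (θ a) (θ b))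
    (hd : DenseRange θ) : ∃ Q', IsVirtualDiagonal mS Q' := by
  let pull : (S →L[ℂ] S →L[ℂ] ℂ) →L[ℂ] (T →L[ℂ] T →L[ℂ] ℂ) :=
    ((ContinuousLinearMap.compL ℂ T S (T →L[ℂ] ℂ)).flip θ) ∘L
      (ContinuousLinearMap.compL ℂ S (S →L[ℂ] ℂ) (T →L[ℂ] ℂ)
        ((ContinuousLinearMap.compL ℂ T S ℂ).flip θ))
  have hp : ∀ β x y, pull β x y = β (θ x) (θ y) := fun β x y => rfl
  refine ⟨Q ∘L pull, .of_total (s := Set.range θ) (hd.mono Submodule.subset_span) ?_ ?_⟩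
  · rintro _ ⟨a, rfl⟩ β
    exact hQ.balanced a (pull β) _ _ (fun x y => by simp [hp, hθ]) (fun x y => by simp [hp, hθ])
  · rintro _ ⟨a, rfl⟩ l
    exact hQ.right_unit a (l ∘L θ) _ fun x y => by simp [hp, hθ]

end VirtualDiagonal

/-! ## Extensions to completions -/

section CompletionMaps

variable {V W G : Type*} [AddCommGroup V] [Module ℂ V] [AddCommGroup W] [Module ℂ W]
  [NormedAddCommGroup G] [NormedSpace ℂ G]

/-- `toCompletion` as a linear map. -/
def toCompletionₗ (p : Seminorm ℂ V) : V →ₗ[ℂ] SeminormCompletion p :=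
  (UniformSpace.Completion.toComplL (𝕜 := ℂ) (E := SeminormSpace p)).toLinearMap

@[simp] theorem toCompletionₗ_apply (p : Seminorm ℂ V) (v : V) :
    toCompletionₗ p v = toCompletion p v := rfl

@[simp] theorem norm_toCompletion (p : Seminorm ℂ V) (v : V) : ‖toCompletion p v‖ = p v :=
  UniformSpace.Completion.norm_coe (E := SeminormSpace p) v

theorem denseRange_toCompletion (p : Seminorm ℂ V) : DenseRange (toCompletion p) :=
  UniformSpace.Completion.denseRange_coe (α := SeminormSpace p)

/-- A bilinear map dominated by the norms along two linear maps with dense ranges extends. -/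
theorem exists_bilinear_extension_of_dense [CompleteSpace G] {V' W' : Type*}
    [NormedAddCommGroup V'] [NormedSpace ℂ V'] [NormedAddCommGroup W'] [NormedSpace ℂ W']
    {e₁ : V →ₗ[ℂ] V'} {e₂ : W →ₗ[ℂ] W'} (h₁ : DenseRange e₁) (h₂ : DenseRange e₂)
    (f : V →ₗ[ℂ] W →ₗ[ℂ] G) (C : ℝ) (hC : 0 ≤ C)
    (hf : ∀ v w, ‖f v w‖ ≤ C * ‖e₁ v‖ * ‖e₂ w‖) :
    ∃ g : V' →L[ℂ] W' →L[ℂ] G, (∀ v w, g (e₁ v) (e₂ w) = f v w) ∧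
      ∀ s t, ‖g s t‖ ≤ C * ‖s‖ * ‖t‖ := by
  have hg : ∀ v w, (f v).extendOfNorm e₂ (e₂ w) = f v w := fun v w =>
    LinearMap.extendOfNorm_eq h₂ ⟨_, hf v⟩ w
  have hext : ∀ h k : W' →L[ℂ] G, (∀ w, h (e₂ w) = k (e₂ w)) → h = k := fun h k hhk =>
    DFunLike.coe_injective (h₂.equalizer h.continuous k.continuous (funext hhk))
  let f₂ : V →ₗ[ℂ] W' →L[ℂ] G :=
    { toFun := fun v => (f v).extendOfNorm e₂
      map_add' := fun v w => hext _ _ fun x => by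
        rw [hg, _root_.add_apply, hg, hg, map_add, LinearMap.add_apply]
      map_smul' := fun c v => hext _ _ fun x => by
        rw [hg, _root_.smul_apply, hg, map_smul, LinearMap.smul_apply, RingHom.id_apply] }
  have hf₂ : ∀ v, ‖f₂ v‖ ≤ C * ‖e₁ v‖ := fun v =>
    LinearMap.opNorm_extendOfNorm_le h₂ (by positivity) (hf v)
  refine ⟨f₂.extendOfNorm e₁, fun v w => ?_, fun s t => ?_⟩
  · rw [LinearMap.extendOfNorm_eq h₁ ⟨_, hf₂⟩]
    exact hg v w
  · exact (f₂.extendOfNorm e₁ s).le_of_opNorm_le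
      (LinearMap.norm_extendOfNorm_apply_le h₁ C hf₂ s) t

/-- A linear map dominated by a seminorm extends to the completion. -/
theorem exists_extension_completion [CompleteSpace G] {p : Seminorm ℂ V} (f : V →ₗ[ℂ] G) (C : ℝ)
    (hf : ∀ v, ‖f v‖ ≤ C * p v) :
    ∃ g : SeminormCompletion p →L[ℂ] G, (∀ v, g (toCompletion p v) = f v) ∧
      ∀ t, ‖g t‖ ≤ C * ‖t‖ := by
  have hd : DenseRange (toCompletionₗ p) := denseRange_toCompletion p
  have hn : ∀ v, ‖f v‖ ≤ C * ‖toCompletionₗ p v‖ := fun v => by simpa using hf v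
  exact ⟨f.extendOfNorm (toCompletionₗ p), fun v => LinearMap.extendOfNorm_eq hd ⟨C, hn⟩ v,
    LinearMap.norm_extendOfNorm_apply_le hd C hn⟩

/-- A bilinear map dominated by seminorms extends to the completions. -/
theorem exists_bilinear_extension_completion [CompleteSpace G] {p : Seminorm ℂ V}
    {q : Seminorm ℂ W} (f : V →ₗ[ℂ] W →ₗ[ℂ] G) (C : ℝ) (hC : 0 ≤ C)
    (hf : ∀ v w, ‖f v w‖ ≤ C * p v * q w) :
    ∃ g : SeminormCompletion p →L[ℂ] SeminormCompletion q →L[ℂ] G,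
      ∀ v w, g (toCompletion p v) (toCompletion q w) = f v w := by
  obtain ⟨g, hg, -⟩ := exists_bilinear_extension_of_dense (e₁ := toCompletionₗ p)
    (e₂ := toCompletionₗ q) (denseRange_toCompletion p) (denseRange_toCompletion q) f C hC
    (by simpa using hf)
  exact ⟨g, hg⟩

end CompletionMaps

/-! ## Tensor norms -/

section TensorNorms

variable {E F G : Type*} [NormedAddCommGroup E] [NormedSpace ℂ E]
  [NormedAddCommGroup F] [NormedSpace ℂ F] [NormedAddCommGroup G] [NormedSpace ℂ G]

theorem seminorm_list_sum_le {V ι : Type*} [AddCommGroup V] [Module ℂ V] (p : Seminorm ℂ V)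
    (l : List ι) (f : ι → V) (g : ι → ℝ) (h : ∀ i, p (f i) ≤ g i) :
    p (l.map f).sum ≤ (l.map g).sum := by
  induction l with
  | nil => simp
  | cons a l ih =>
    simp only [List.map_cons, List.sum_cons]
    exact (map_add_le_add p _ _).trans (add_le_add (h a) ih)

/-- A seminorm that is bounded on elementary tensors is dominated by the projective norm. -/
theorem le_projNorm (p : Seminorm ℂ (E ⊗[ℂ] F)) (C : ℝ) (hC : 0 ≤ C)
    (h : ∀ x y, p (x ⊗ₜ y) ≤ C * (‖x‖ * ‖y‖)) (u : E ⊗[ℂ] F) : p u ≤ C * projNorm E F u := by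
  change p u ≤ C * sInf (projValues E F u)
  rw [← smul_eq_mul, ← Real.sInf_smul_of_nonneg hC]
  refine le_csInf (projValues_nonempty u).smul_set ?_
  rintro _ ⟨_, ⟨l, rfl, rfl⟩, rfl⟩
  simp only [smul_eq_mul]
  rw [← List.sum_map_mul_left]
  exact seminorm_list_sum_le p l _ _ fun q => h q.1 q.2

theorem projNorm_tmul_le (x : E) (y : F) : projNorm E F (x ⊗ₜ y) ≤ ‖x‖ * ‖y‖ :=
  csInf_le (projValues_bddBelow _) ⟨[(x, y)], by simp, by simp⟩

theorem norm_apply_le_injNorm (u : E ⊗[ℂ] F) (φ : StrongDual ℂ E) (ψ : StrongDual ℂ F) :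
    ‖tensorForm E F u φ ψ‖ ≤ injNorm E F u * ‖φ‖ * ‖ψ‖ :=
  (tensorForm E F u).le_opNorm₂ φ ψ

theorem injNorm_le {u : E ⊗[ℂ] F} {C : ℝ} (hC : 0 ≤ C)
    (h : ∀ φ ψ, ‖tensorForm E F u φ ψ‖ ≤ C * ‖φ‖ * ‖ψ‖) : injNorm E F u ≤ C :=
  ContinuousLinearMap.opNorm_le_bound₂ _ hC h

theorem injNorm_tmul_le (x : E) (y : F) : injNorm E F (x ⊗ₜ y) ≤ ‖x‖ * ‖y‖ := by
  refine injNorm_le (by positivity) fun φ ψ => ?_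
  rw [tensorForm_tmul, norm_mul]
  calc ‖φ x‖ * ‖ψ y‖ ≤ (‖φ‖ * ‖x‖) * (‖ψ‖ * ‖y‖) := by
        gcongr
        · exact φ.le_opNorm x
        · exact ψ.le_opNorm y
    _ = ‖x‖ * ‖y‖ * ‖φ‖ * ‖ψ‖ := by ring

theorem injNorm_le_projNorm (u : E ⊗[ℂ] F) : injNorm E F u ≤ projNorm E F u := by
  simpa using le_projNorm (injNorm E F) 1 zero_le_one
    (fun x y => by simpa using injNorm_tmul_le x y) u

/-- The slice map `φ ⊗ id`. -/
def leftSlice (F : Type*) [NormedAddCommGroup F] [NormedSpace ℂ F] (φ : StrongDual ℂ E) :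
    E ⊗[ℂ] F →ₗ[ℂ] F :=
  TensorProduct.lift ((LinearMap.lsmul ℂ F).comp φ.toLinearMap)

@[simp] theorem leftSlice_tmul (φ : StrongDual ℂ E) (x : E) (y : F) :
    leftSlice F φ (x ⊗ₜ y) = φ x • y := rfl

theorem apply_leftSlice (φ : StrongDual ℂ E) (ψ : StrongDual ℂ F) (u : E ⊗[ℂ] F) :
    ψ (leftSlice F φ u) = tensorForm E F u φ ψ := by
  induction u using TensorProduct.induction_on with
  | zero => simp
  | add u v hu hv => simp [hu, hv]
  | tmul x y => simp [tensorForm_tmul]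

/-- By Hahn–Banach the slice is tested on functionals `ψ`, where it takes the values of the bilinear
form of `u`. -/
theorem norm_leftSlice_le (φ : StrongDual ℂ E) (u : E ⊗[ℂ] F) :
    ‖leftSlice F φ u‖ ≤ ‖φ‖ * injNorm E F u := by
  refine NormedSpace.norm_le_dual_bound ℂ _ (by positivity) fun ψ => ?_
  rw [apply_leftSlice]
  refine (norm_apply_le_injNorm u φ ψ).trans_eq (by ring)

/-- Elementary tensors span a dense subspace of a completed tensor product. -/
theorem dense_span_tmul (p : Seminorm ℂ (E ⊗[ℂ] F)) :
    Dense (Submodule.span ℂ {t | ∃ x y, t = toCompletion p (x ⊗ₜ y)} :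
      Set (SeminormCompletion p)) := by
  refine (denseRange_toCompletion p).mono ?_
  rintro _ ⟨u, rfl⟩
  rw [SetLike.mem_coe, ← toCompletionₗ_apply]
  induction u using TensorProduct.induction_on with
  | zero => rw [map_zero]; exact zero_mem _
  | add u v hu hv => rw [map_add]; exact add_mem hu hv
  | tmul x y => exact Submodule.subset_span ⟨x, y, rfl⟩

/-- The canonical bilinear map into a completed tensor product. -/
def tensorMk (p : Seminorm ℂ (E ⊗[ℂ] F)) (hp : ∀ x y, p (x ⊗ₜ y) ≤ ‖x‖ * ‖y‖) :
    E →L[ℂ] F →L[ℂ] SeminormCompletion p :=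
  LinearMap.mkContinuous₂ ((TensorProduct.mk ℂ E F).compr₂ (toCompletionₗ p)) 1 fun x y => by
    simpa using hp x y

@[simp] theorem tensorMk_apply (p : Seminorm ℂ (E ⊗[ℂ] F))
    (hp : ∀ x y, p (x ⊗ₜ y) ≤ ‖x‖ * ‖y‖) (x : E) (y : F) :
    tensorMk p hp x y = toCompletion p (x ⊗ₜ y) := rfl

end TensorNorms

/-! ## Multiplications of completed tensor products -/

section TensorMul

variable {E F : Type*} [NormedAddCommGroup E] [NormedSpace ℂ E]
  [NormedAddCommGroup F] [NormedSpace ℂ F]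

/-- The multiplication `(x ⊗ y) (x' ⊗ y') = x x' ⊗ y y'` of the algebraic tensor product. -/
def algTensorMul (mE : E →L[ℂ] E →L[ℂ] E) (mF : F →L[ℂ] F →L[ℂ] F) :
    E ⊗[ℂ] F →ₗ[ℂ] E ⊗[ℂ] F →ₗ[ℂ] E ⊗[ℂ] F :=
  TensorProduct.map₂ (ContinuousLinearMap.toLinearMap₁₂ mE) (ContinuousLinearMap.toLinearMap₁₂ mF)

@[simp] theorem algTensorMul_tmul (mE : E →L[ℂ] E →L[ℂ] E) (mF : F →L[ℂ] F →L[ℂ] F)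
    (x x' : E) (y y' : F) :
    algTensorMul mE mF (x ⊗ₜ y) (x' ⊗ₜ y') = mE x x' ⊗ₜ mF y y' := rfl

/-- A submultiplicative seminorm yields a multiplication on the completed tensor product. -/
theorem exists_isTensorMul {p : Seminorm ℂ (E ⊗[ℂ] F)} {mE : E →L[ℂ] E →L[ℂ] E}
    {mF : F →L[ℂ] F →L[ℂ] F} (C : ℝ) (hC : 0 ≤ C)
    (h : ∀ u v, p (algTensorMul mE mF u v) ≤ C * p u * p v) : ∃ m, IsTensorMul p mE mF m := by
  obtain ⟨m, hm⟩ := exists_bilinear_extension_completion (p := p) (q := p)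
    ((algTensorMul mE mF).compr₂ (toCompletionₗ p)) C hC fun u v => by simpa using h u v
  exact ⟨m, fun x y x' y' => by rw [hm]; rfl⟩

/-- Seminorms bounded on elementary tensors are dominated by the projective norm; this is applied
once in each factor of the product. -/
theorem exists_isTensorMul_projNorm (mE : E →L[ℂ] E →L[ℂ] E) (mF : F →L[ℂ] F →L[ℂ] F) :
    ∃ m, IsTensorMul (projNorm E F) mE mF m := by
  refine exists_isTensorMul (‖mE‖ * ‖mF‖) (by positivity) fun u v => ?_
  rw [mul_right_comm]
  refine le_projNorm ((projNorm E F).comp ((algTensorMul mE mF).flip v)) _ (by positivity)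
    (fun x y => ?_) u
  have := le_projNorm ((projNorm E F).comp (algTensorMul mE mF (x ⊗ₜ y)))
    (‖mE‖ * ‖mF‖ * (‖x‖ * ‖y‖)) (by positivity) (fun x' y' => ?_) v
  · simp only [Seminorm.comp_apply, LinearMap.flip_apply] at this ⊢
    linarith
  · simp only [Seminorm.comp_apply, algTensorMul_tmul]
    calc projNorm E F (mE x x' ⊗ₜ mF y y') ≤ ‖mE x x'‖ * ‖mF y y'‖ := projNorm_tmul_le _ _
      _ ≤ (‖mE‖ * ‖x‖ * ‖x'‖) * (‖mF‖ * ‖y‖ * ‖y'‖) := by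
        gcongr
        · exact mE.le_opNorm₂ x x'
        · exact mF.le_opNorm₂ y y'
      _ = _ := by ring

variable {p : Seminorm ℂ (E ⊗[ℂ] F)} {mE : E →L[ℂ] E →L[ℂ] E} {mF : F →L[ℂ] F →L[ℂ] F}
  {m : SeminormCompletion p →L[ℂ] SeminormCompletion p →L[ℂ] SeminormCompletion p}

/-- A bounded map that is multiplicative on elementary tensors is multiplicative. -/
theorem IsTensorMul.map_mul_of_tmul (hm : IsTensorMul p mE mF m) {G : Type*}
    [NormedAddCommGroup G] [NormedSpace ℂ G] {mG : G →L[ℂ] G →L[ℂ] G}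
    (θ : SeminormCompletion p →L[ℂ] G)
    (h : ∀ x y x' y', θ (toCompletion p (mE x x' ⊗ₜ mF y y')) =
      mG (θ (toCompletion p (x ⊗ₜ y))) (θ (toCompletion p (x' ⊗ₜ y')))) (s t) :
    θ (m s t) = mG (θ s) (θ t) := by
  have e : (ContinuousLinearMap.compL ℂ _ _ _ θ) ∘L m = mG.bilinearComp θ θ := by
    refine ContinuousLinearMap.ext_on (dense_span_tmul p) ?_
    rintro _ ⟨x, y, rfl⟩
    refine ContinuousLinearMap.ext_on (dense_span_tmul p) ?_
    rintro _ ⟨x', y', rfl⟩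
    refine Eq.trans (congrArg θ (hm x y x' y')) (h x y x' y')
  exact DFunLike.congr_fun (DFunLike.congr_fun e s) t

/-- Elementary tensors are replaced by arbitrary elements one variable at a time, from right to
left, by density and continuity. -/
theorem IsTensorMul.assoc (hm : IsTensorMul p mE mF m)
    (hE : ∀ a b c, mE (mE a b) c = mE a (mE b c)) (hF : ∀ a b c, mF (mF a b) c = mF a (mF b c))
    (r s t) : m (m r s) t = m r (m s t) := by
  have e₁ : ∀ x y x' y' t, m (m (toCompletion p (x ⊗ₜ y)) (toCompletion p (x' ⊗ₜ y'))) t =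
      m (toCompletion p (x ⊗ₜ y)) (m (toCompletion p (x' ⊗ₜ y')) t) := by
    intro x y x' y' t
    have e : m (m (toCompletion p (x ⊗ₜ y)) (toCompletion p (x' ⊗ₜ y'))) =
        m (toCompletion p (x ⊗ₜ y)) ∘L m (toCompletion p (x' ⊗ₜ y')) := by
      refine ContinuousLinearMap.ext_on (dense_span_tmul p) ?_
      rintro _ ⟨x'', y'', rfl⟩
      simp only [ContinuousLinearMap.comp_apply, hm _ _ _ _, hE, hF]
    exact DFunLike.congr_fun e t
  have e₂ : ∀ x y s t, m (m (toCompletion p (x ⊗ₜ y)) s) t =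
      m (toCompletion p (x ⊗ₜ y)) (m s t) := by
    intro x y s t
    have e : m.flip t ∘L m (toCompletion p (x ⊗ₜ y)) =
        m (toCompletion p (x ⊗ₜ y)) ∘L m.flip t := by
      refine ContinuousLinearMap.ext_on (dense_span_tmul p) ?_
      rintro _ ⟨x', y', rfl⟩
      exact e₁ x y x' y' t
    exact DFunLike.congr_fun e s
  have e : m.flip t ∘L m.flip s = m.flip (m s t) := by
    refine ContinuousLinearMap.ext_on (dense_span_tmul p) ?_
    rintro _ ⟨x, y, rfl⟩
    exact e₂ x y s t
  exact DFunLike.congr_fun e r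

end TensorMul

/-! ## Virtual diagonals of tensor products -/

section TensorDiagonal

variable {E F : Type*} [NormedAddCommGroup E] [NormedSpace ℂ E]
  [NormedAddCommGroup F] [NormedSpace ℂ F] {T : Type*} [NormedAddCommGroup T] [NormedSpace ℂ T]

/-- For a bilinear map `τ : E × F → T` and a functional `M` on the bilinear forms on `F`, the
operator taking `β` to `(b, b') ↦ M ((a, a') ↦ β (τ b a) (τ b' a'))`. -/
def sliceForm (τ : E →L[ℂ] F →L[ℂ] T) (M : StrongDual ℂ (F →L[ℂ] F →L[ℂ] ℂ)) :
    (T →L[ℂ] T →L[ℂ] ℂ) →L[ℂ] (E →L[ℂ] E →L[ℂ] ℂ) :=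
  let K : E →L[ℂ] (T →L[ℂ] ℂ) →L[ℂ] (F →L[ℂ] ℂ) := (ContinuousLinearMap.compL ℂ F T ℂ).flip ∘L τ
  let U : (F →L[ℂ] T →L[ℂ] ℂ) →L[ℂ] (E →L[ℂ] ℂ) :=
    (ContinuousLinearMap.compL ℂ E (F →L[ℂ] F →L[ℂ] ℂ) ℂ M) ∘L
    ((ContinuousLinearMap.compL ℂ E ((T →L[ℂ] ℂ) →L[ℂ] (F →L[ℂ] ℂ))
      (F →L[ℂ] F →L[ℂ] ℂ)).flip K) ∘L
    (ContinuousLinearMap.compL ℂ F (T →L[ℂ] ℂ) (F →L[ℂ] ℂ)).flip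
  (ContinuousLinearMap.compL ℂ E (F →L[ℂ] T →L[ℂ] ℂ) (E →L[ℂ] ℂ) U) ∘L
    ((ContinuousLinearMap.compL ℂ E (F →L[ℂ] T) (F →L[ℂ] T →L[ℂ] ℂ)).flip τ) ∘L
    ContinuousLinearMap.compL ℂ F T (T →L[ℂ] ℂ)

theorem sliceForm_apply (τ : E →L[ℂ] F →L[ℂ] T) (M : StrongDual ℂ (F →L[ℂ] F →L[ℂ] ℂ))
    (β : T →L[ℂ] T →L[ℂ] ℂ) (b b' : E) :
    sliceForm τ M β b b' = M (β.bilinearComp (τ b) (τ b')) := rfl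

/-- Virtual diagonals of two algebras yield one of a completed tensor product. -/
theorem IsVirtualDiagonal.tensor {mE : E →L[ℂ] E →L[ℂ] E} {mF : F →L[ℂ] F →L[ℂ] F}
    {N : StrongDual ℂ (E →L[ℂ] E →L[ℂ] ℂ)} {M : StrongDual ℂ (F →L[ℂ] F →L[ℂ] ℂ)}
    (hN : IsVirtualDiagonal mE N) (hM : IsVirtualDiagonal mF M) {p : Seminorm ℂ (E ⊗[ℂ] F)}
    (hp : ∀ x y, p (x ⊗ₜ y) ≤ ‖x‖ * ‖y‖)
    {m : SeminormCompletion p →L[ℂ] SeminormCompletion p →L[ℂ] SeminormCompletion p}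
    (hm : IsTensorMul p mE mF m) : ∃ Q, IsVirtualDiagonal m Q := by
  refine ⟨N ∘L sliceForm (tensorMk p hp) M, .of_total (dense_span_tmul p) ?_ ?_⟩
  · rintro _ ⟨b₀, a₀, rfl⟩ β
    -- The two factors are moved separately: `M` carries `a₀` across for fixed `b`, `b'`, and `N`
    -- carries `b₀` across in the intermediate form where `a₀` is already on the right.
    refine hN.balanced b₀ (sliceForm (tensorMk p hp) (M ∘L rightAction mF a₀) β) _ _
      (fun b b' => ?_) (fun b b' => ?_)
    · refine hM.balanced a₀ (β.bilinearComp (tensorMk p hp (mE b₀ b)) (tensorMk p hp b')) _ _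
        (fun a a' => ?_) (fun a a' => rfl)
      simp [hm _ _ _ _]
    · refine congrArg M ?_
      ext a a'
      simp [hm _ _ _ _]
  · rintro _ ⟨b₀, a₀, rfl⟩ l
    refine hN.right_unit b₀ (l ∘L (tensorMk p hp).flip a₀) _ fun b b' => ?_
    refine hM.right_unit a₀ (l ∘L tensorMk p hp (mE (mE b b') b₀)) _ fun a a' => ?_
    simp [hm _ _ _ _]

end TensorDiagonal

/-! ## Characters and virtual diagonals -/

section Characters

/-- A virtual diagonal keeps distinct characters apart. -/
theorem IsVirtualDiagonal.one_le_norm_sub {T : Type*} [NormedAddCommGroup T] [NormedSpace ℂ T]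
    {m : T →L[ℂ] T →L[ℂ] T} {Q : StrongDual ℂ (T →L[ℂ] T →L[ℂ] ℂ)} (hQ : IsVirtualDiagonal m Q)
    {χ₁ χ₂ : StrongDual ℂ T} (h₁ : ∀ a b, χ₁ (m a b) = χ₁ a * χ₁ b)
    (h₂ : ∀ a b, χ₂ (m a b) = χ₂ a * χ₂ b) (h0 : χ₁ ≠ 0) (hne : χ₁ ≠ χ₂) :
    1 ≤ ‖Q‖ * (‖χ₁‖ * ‖χ₁ - χ₂‖) := by
  obtain ⟨a, ha⟩ := DFunLike.ne_iff.1 h0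
  obtain ⟨t, ht⟩ := DFunLike.ne_iff.1 hne
  -- The form `χ₁ (x y a)` is `χ₁ a` times `χ₁ ⊗ χ₁`, and `right_unit` gives it the value `χ₁ a ≠
  -- 0`.
  have e₁ : Q (χ₁.smulRight χ₁) = 1 := by
    have := hQ.right_unit a χ₁ (χ₁ a • χ₁.smulRight χ₁) fun x y => by
      simp [h₁]; ring
    rw [map_smul, smul_eq_mul] at this
    exact (mul_eq_left₀ ha).1 this
  -- Balancing at `t` multiplies the value by `χ₁ t` on one side and by `χ₂ t ≠ χ₁ t` on the other.
  have e₂ : Q (χ₁.smulRight χ₂) = 0 := by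
    have := hQ.balanced t (χ₁.smulRight χ₂) (χ₁ t • χ₁.smulRight χ₂) (χ₂ t • χ₁.smulRight χ₂)
      (fun x y => by simp [h₁]; ring) (fun x y => by simp [h₂]; ring)
    rw [map_smul, map_smul, ← sub_eq_zero, ← sub_smul] at this
    exact (smul_eq_zero.1 this).resolve_left (sub_ne_zero.2 ht)
  have e : Q (χ₁.smulRight (χ₁ - χ₂)) = 1 := by
    rw [← e₁, ← sub_zero (Q (χ₁.smulRight χ₁)), ← e₂, ← map_sub]
    congr 1
    ext x y
    simp [mul_sub]
  calc (1 : ℝ) = ‖Q (χ₁.smulRight (χ₁ - χ₂))‖ := by rw [e, norm_one]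
    _ ≤ ‖Q‖ * ‖χ₁.smulRight (χ₁ - χ₂)‖ := Q.le_opNorm _
    _ = ‖Q‖ * (‖χ₁‖ * ‖χ₁ - χ₂‖) := by rw [ContinuousLinearMap.norm_smulRight_apply]

variable {E F : Type*} [NormedAddCommGroup E] [NormedSpace ℂ E]
  [NormedAddCommGroup F] [NormedSpace ℂ F]

/-- Slices are bounded for the injective norm, hence for every larger seminorm; this covers both
tensor products. -/
theorem exists_leftSlice_extension [CompleteSpace F] {p : Seminorm ℂ (E ⊗[ℂ] F)}
    (hp : ∀ u, injNorm E F u ≤ p u) (φ : StrongDual ℂ E) :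
    ∃ θ : SeminormCompletion p →L[ℂ] F,
      (∀ u, θ (toCompletion p u) = leftSlice F φ u) ∧ ‖θ‖ ≤ ‖φ‖ := by
  obtain ⟨θ, h, hn⟩ := exists_extension_completion (p := p) (leftSlice F φ) ‖φ‖ fun u =>
    (norm_leftSlice_le φ u).trans (mul_le_mul_of_nonneg_left (hp u) (norm_nonneg _))
  exact ⟨θ, h, θ.opNorm_le_bound (norm_nonneg _) hn⟩

/-- If a completed tensor product has a virtual diagonal, then distinct characters of the first
factor are uniformly apart. -/
theorem IsVirtualDiagonal.one_le_norm_sub_of_tensor [CompleteSpace F]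
    {p : Seminorm ℂ (E ⊗[ℂ] F)} (hp : ∀ u, injNorm E F u ≤ p u)
    {mE : E →L[ℂ] E →L[ℂ] E} {mF : F →L[ℂ] F →L[ℂ] F}
    {m : SeminormCompletion p →L[ℂ] SeminormCompletion p →L[ℂ] SeminormCompletion p}
    (hm : IsTensorMul p mE mF m) {Q} (hQ : IsVirtualDiagonal m Q) {ψ : StrongDual ℂ F}
    (hψ : ∀ a b, ψ (mF a b) = ψ a * ψ b) (hψ0 : ψ ≠ 0) {φ₁ φ₂ : StrongDual ℂ E}
    (h₁ : ∀ a b, φ₁ (mE a b) = φ₁ a * φ₁ b) (h₂ : ∀ a b, φ₂ (mE a b) = φ₂ a * φ₂ b)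
    (h0 : φ₁ ≠ 0) (hn : ‖φ₁‖ ≤ 1) (hne : φ₁ ≠ φ₂) :
    1 ≤ ‖Q‖ * ‖ψ‖ ^ 2 * ‖φ₁ - φ₂‖ := by
  obtain ⟨θ₁, e₁, n₁⟩ := exists_leftSlice_extension (F := F) hp φ₁
  obtain ⟨θ₂, e₂, -⟩ := exists_leftSlice_extension (F := F) hp φ₂
  obtain ⟨θ, e, n⟩ := exists_leftSlice_extension (F := F) hp (φ₁ - φ₂)
  -- Identifying the difference with the slice at `φ₁ - φ₂` bounds its norm by `‖φ₁ - φ₂‖`.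
  have hθ : θ₁ - θ₂ = θ := by
    refine ContinuousLinearMap.ext_on (dense_span_tmul p) ?_
    rintro _ ⟨x, y, rfl⟩
    simp [e₁, e₂, e, sub_smul]
  obtain ⟨y, hy⟩ := DFunLike.ne_iff.1 hψ0
  obtain ⟨x, hx⟩ := DFunLike.ne_iff.1 h0
  obtain ⟨x', hx'⟩ := DFunLike.ne_iff.1 hne
  have mul : ∀ (φ : StrongDual ℂ E) (θ : SeminormCompletion p →L[ℂ] F),
      (∀ u, θ (toCompletion p u) = leftSlice F φ u) → (∀ a b, φ (mE a b) = φ a * φ b) →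
      ∀ s t, (ψ ∘L θ) (m s t) = (ψ ∘L θ) s * (ψ ∘L θ) t := fun φ θ e h s t =>
    hm.map_mul_of_tmul (mG := ContinuousLinearMap.mul ℂ ℂ) (ψ ∘L θ) (fun x y x' y' => by
      simp only [ContinuousLinearMap.comp_apply, e, leftSlice_tmul, map_smul, h, hψ, smul_eq_mul,
        ContinuousLinearMap.mul_apply']
      ring) s t
  have key := hQ.one_le_norm_sub (mul φ₁ θ₁ e₁ h₁) (mul φ₂ θ₂ e₂ h₂)
    (fun h => by
      have := DFunLike.congr_fun h (toCompletion p (x ⊗ₜ y))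
      simp only [ContinuousLinearMap.comp_apply, e₁, leftSlice_tmul, map_smul, smul_eq_mul,
        _root_.zero_apply] at this
      exact (mul_ne_zero hx hy) this)
    (fun h => by
      have := DFunLike.congr_fun h (toCompletion p (x' ⊗ₜ y))
      simp only [ContinuousLinearMap.comp_apply, e₁, e₂, leftSlice_tmul, map_smul,
        smul_eq_mul] at this
      exact hx' (mul_right_cancel₀ hy this))
  refine key.trans ?_
  have k₁ : ‖ψ ∘L θ₁‖ ≤ ‖ψ‖ :=
    (ContinuousLinearMap.opNorm_comp_le _ _).trans
      (mul_le_of_le_one_right (norm_nonneg _) (n₁.trans hn))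
  have k₂ : ‖ψ ∘L θ₁ - ψ ∘L θ₂‖ ≤ ‖ψ‖ * ‖φ₁ - φ₂‖ := by
    rw [← ContinuousLinearMap.comp_sub, hθ]
    exact (ContinuousLinearMap.opNorm_comp_le _ _).trans
      (mul_le_mul_of_nonneg_left n (norm_nonneg _))
  calc ‖Q‖ * (‖ψ ∘L θ₁‖ * ‖ψ ∘L θ₁ - ψ ∘L θ₂‖) ≤ ‖Q‖ * (‖ψ‖ * (‖ψ‖ * ‖φ₁ - φ₂‖)) := by gcongr
    _ = ‖Q‖ * ‖ψ‖ ^ 2 * ‖φ₁ - φ₂‖ := by ring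

end Characters

/-! ## Necessary conditions for amenability -/

section Necessity

theorem arens_assoc {E : Type*} [NormedAddCommGroup E] [NormedSpace ℂ E]
    {m : E →L[ℂ] E →L[ℂ] E} (hm : ∀ a b c, m (m a b) c = m a (m b c)) (Φ Ψ Ω : Bidual E) :
    arens m (arens m Φ Ψ) Ω = arens m Φ (arens m Ψ Ω) := by
  ext l
  refine congrArg Φ ?_
  ext x
  refine congrArg Ψ ?_
  ext y
  refine congrArg Ω ?_
  ext z
  exact congrArg l (hm x y z)

/-- The second adjoint of a multiplicative functional is multiplicative. -/
theorem arens_apply_of_mul {E : Type*} [NormedAddCommGroup E] [NormedSpace ℂ E]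
    {m : E →L[ℂ] E →L[ℂ] E} {φ : StrongDual ℂ E} (hφ : ∀ a b, φ (m a b) = φ a * φ b)
    (Φ Ψ : Bidual E) : arens m Φ Ψ φ = Φ φ * Ψ φ := by
  have e₁ : ∀ x, bilinAdjoint m φ x = φ x • φ := fun x => by
    ext y; simp [bilinAdjoint_apply, hφ]
  have e₂ : bilinAdjoint (bilinAdjoint m) Ψ φ = Ψ φ • φ := by
    ext x
    rw [bilinAdjoint_apply, e₁]
    simp [mul_comm]
  rw [(arens_apply m Φ Ψ φ).1, e₂, map_smul, smul_eq_mul, mul_comm]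

section

variable (A : Type*) [NonUnitalNormedRing A] [NormedSpace ℂ A]
  [IsScalarTower ℂ A A] [SMulCommClass ℂ A A]

theorem bidualMul_assoc (Φ Ψ Ω : Bidual A) :
    bidualMul A (bidualMul A Φ Ψ) Ω = bidualMul A Φ (bidualMul A Ψ Ω) :=
  arens_assoc (fun a b c => by simp [mul_assoc]) Φ Ψ Ω

variable {A}

theorem bidualMul_apply_of_mul {φ : StrongDual ℂ A} (hφ : ∀ a b, φ (a * b) = φ a * φ b)
    (Φ Ψ : Bidual A) : bidualMul A Φ Ψ φ = Φ φ * Ψ φ :=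
  arens_apply_of_mul (by simpa using hφ) Φ Ψ

end

variable {X : Type*} [MetricSpace X] [Nonempty X]
  {B : Type*} [NonUnitalNormedRing B] [NormedSpace ℂ B] [IsScalarTower ℂ B B] [SMulCommClass ℂ B B]
  {A : Type*} [NonUnitalNormedRing A] [NormedSpace ℂ A] [IsScalarTower ℂ A A] [SMulCommClass ℂ A A]

/-- If a completed tensor product of `B**` and `A**` is amenable, then so is `A**`, and any family
of characters of `B` that depends on the points of `X` in a `1`-Lipschitz way is uniformly
discrete. -/
theorem IsAmenableTensor.necessary {p : Seminorm ℂ (Bidual B ⊗[ℂ] Bidual A)}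
    (hp : ∀ u, injNorm (Bidual B) (Bidual A) u ≤ p u)
    (h : IsAmenableTensor p (bidualMul B) (bidualMul A))
    (hA : (WeakDual.characterSpace ℂ A).Nonempty)
    (ev : X → StrongDual ℂ B) (hev : ∀ x f g, ev x (f * g) = ev x f * ev x g)
    (h0 : ∀ x, ev x ≠ 0) (hn : ∀ x, ‖ev x‖ ≤ 1) (hd : ∀ x y, ‖ev x - ev y‖ ≤ dist x y) :
    IsAmenable (bidualMul A) ∧ ∃ δ : ℝ, 0 < δ ∧ ∀ x y, ev x ≠ ev y → δ ≤ dist x y := by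
  obtain ⟨m, hm, ham⟩ := h
  obtain ⟨Q, hQ⟩ := ham.exists_virtualDiagonal
    (hm.assoc (bidualMul_assoc B) (bidualMul_assoc A))
  let ι : StrongDual ℂ B →L[ℂ] StrongDual ℂ (Bidual B) := NormedSpace.inclusionInDoubleDual ℂ _
  have hι : ∀ l, ‖ι l‖ ≤ ‖l‖ := NormedSpace.double_dual_bound ℂ _
  have hιmul : ∀ x Φ Ψ, ι (ev x) (bidualMul B Φ Ψ) = ι (ev x) Φ * ι (ev x) Ψ := fun x Φ Ψ =>
    bidualMul_apply_of_mul (hev x) Φ Ψ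
  have hιinj : Function.Injective ι := fun l l' hl => by
    ext b
    exact DFunLike.congr_fun hl (NormedSpace.inclusionInDoubleDual ℂ B b)
  have hι0 : ∀ x, ι (ev x) ≠ 0 := fun x => by
    rw [← map_zero ι]
    exact hιinj.ne (h0 x)
  refine ⟨?_, ?_⟩
  -- The slice at the second adjoint of `ev x` is a homomorphism onto `A**`: it takes `Φ ⊗ a` to `a`
  -- once `Φ` is normalized.
  · let x : X := Classical.arbitrary X
    obtain ⟨θ, hθ, -⟩ := exists_leftSlice_extension (F := Bidual A) hp (ι (ev x))
    obtain ⟨Φ, hΦ⟩ := DFunLike.ne_iff.1 (hι0 x)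
    obtain ⟨Q', hQ'⟩ := hQ.map (mS := bidualMul A) θ
      (hm.map_mul_of_tmul θ fun Φ a Φ' a' => by
        simp only [hθ, leftSlice_tmul, hιmul, map_smul, _root_.smul_apply, smul_smul]
        rw [mul_comm])
      (Function.Surjective.denseRange fun a =>
        ⟨toCompletion p (((ι (ev x) Φ)⁻¹ • Φ) ⊗ₜ a), by
          rw [hθ, leftSlice_tmul, map_smul, smul_eq_mul, inv_mul_cancel₀ hΦ, one_smul]⟩)
    exact hQ'.isAmenable (bidualMul_assoc A)
  · obtain ⟨ψ, hψ⟩ := hA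
    let ψ' : StrongDual ℂ A := WeakDual.toStrongDual ψ
    have hψmul : ∀ a b, ψ' (a * b) = ψ' a * ψ' b := hψ.2
    have hψ0 : ψ' ≠ 0 := fun h => hψ.1 (DFunLike.ext _ _ fun a => DFunLike.congr_fun h a)
    let κ : StrongDual ℂ (Bidual A) := NormedSpace.inclusionInDoubleDual ℂ _ ψ'
    have hκ0 : κ ≠ 0 := fun h => hψ0 <| by
      ext a
      exact DFunLike.congr_fun h (NormedSpace.inclusionInDoubleDual ℂ A a)
    have key : ∀ x y, ev x ≠ ev y → 1 ≤ ‖Q‖ * ‖κ‖ ^ 2 * dist x y := fun x y hxy => by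
      refine (hQ.one_le_norm_sub_of_tensor hp hm (ψ := κ) (bidualMul_apply_of_mul hψmul) hκ0
        (hιmul x) (hιmul y) (hι0 x) ((hι _).trans (hn x)) (hιinj.ne hxy)).trans ?_
      rw [← map_sub]
      exact mul_le_mul_of_nonneg_left ((hι _).trans (hd x y)) (by positivity)
    -- The added `1` keeps the constant invertible without having to exclude `Q = 0`.
    refine ⟨(‖Q‖ * ‖κ‖ ^ 2 + 1)⁻¹, by positivity, fun x y hxy => ?_⟩
    rw [inv_le_iff_one_le_mul₀ (by positivity), mul_comm]
    linarith [key x y hxy, dist_nonneg (x := x) (y := y)]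

end Necessity

/-! ## Commutative C⋆-algebras have virtual diagonals -/

section InvariantFunctional

variable {V : Type*} [NormedAddCommGroup V] [NormedSpace ℂ V] {G : Type*} [CommMonoid G]

/-- For an action of a commutative monoid by linear contractions, every bounded functional can be
modified off the fixed vectors so as to become invariant. -/
theorem exists_invariant_functional (ρ : G →* (V →L[ℂ] V)) (hρ : ∀ g, ‖ρ g‖ ≤ 1)
    (N₀ : StrongDual ℂ V) :
    ∃ N : StrongDual ℂ V, (∀ g v, N (ρ g v) = N v) ∧ ∀ v, (∀ g, ρ g v = v) → N v = N₀ v := by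
  let π : MonoidAlgebra ℂ G →ₐ[ℂ] (V →L[ℂ] V) := MonoidAlgebra.lift ℂ (V →L[ℂ] V) G ρ
  have hπ : ∀ g, π (MonoidAlgebra.of ℂ G g) = ρ g := fun g => by simp [π]
  -- The generalized averages: elements of the monoid algebra that act contractively and fix the
  -- invariant vectors. The seminorm `p v`, the infimum of the norms of averages of `v`, equals the
  -- norm on invariant vectors and vanishes on `ρ g v - v`, so a Hahn–Banach extension dominated by
  -- a multiple of it is invariant.
  let S : Submonoid (MonoidAlgebra ℂ G) :=
    { carrier := {w | (∀ v, ‖π w v‖ ≤ ‖v‖) ∧ ∀ v, (∀ g, ρ g v = v) → π w v = v}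
      one_mem' := by simp
      mul_mem' := by
        rintro w w' ⟨h₁, h₂⟩ ⟨h₁', h₂'⟩
        refine ⟨fun v => ?_, fun v hv => ?_⟩
        · rw [map_mul]; exact (h₁ _).trans (h₁' v)
        · rw [map_mul, mul_apply_eq_comp, h₂' v hv, h₂ v hv] }
  have hbdd : ∀ v, BddBelow (Set.range fun w : S => ‖π w v‖) := fun v =>
    ⟨0, by rintro _ ⟨w, rfl⟩; exact norm_nonneg _⟩
  let p : Seminorm ℂ V := Seminorm.ofSMulLE (fun v => ⨅ w : S, ‖π w v‖)
    (le_antisymm ((ciInf_le (hbdd 0) 1).trans (by simp))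
      (Real.iInf_nonneg fun _ => norm_nonneg _))
    -- Commutativity enters here: `w * w'` is at least as good an average for `v` as `w`, and for
    -- `v'` as `w'`.
    (fun v v' => le_ciInf_add_ciInf fun w w' => by
      refine (ciInf_le (hbdd _) (w * w')).trans ?_
      rw [Submonoid.coe_mul, map_add]
      refine (norm_add_le _ _).trans (add_le_add ?_ ?_)
      · rw [mul_comm, map_mul]; exact w'.2.1 _
      · rw [map_mul]; exact w.2.1 _)
    (fun c v => by
      rw [Real.mul_iInf_of_nonneg (norm_nonneg c)]
      exact ciInf_mono (hbdd _) fun w => by rw [map_smul, norm_smul])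
  have hp : ∀ v (w : S), p v ≤ ‖π w v‖ := fun v w => ciInf_le (hbdd v) w
  let W : Submodule ℂ V :=
    { carrier := {v | ∀ g, ρ g v = v}
      add_mem' := fun {a b} ha hb g => by rw [map_add, ha g, hb g]
      zero_mem' := fun g => map_zero _
      smul_mem' := fun c v hv g => by rw [map_smul, hv g] }
  obtain ⟨N, hN, hNp⟩ := Module.Dual.exists_extension_of_le_seminorm W
    (N₀.toLinearMap ∘ₗ W.subtype) (p := ‖N₀‖₊ • p) fun v => by
      have : p v = ‖(v : V)‖ := by
        change (⨅ w : S, ‖π w v‖) = ‖(v : V)‖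
        simp_rw [fun w : S => w.2.2 v v.2]
        exact ciInf_const
      rw [_root_.smul_apply, this]
      exact N₀.le_opNorm v
  have hNp' : ∀ v, ‖N v‖ ≤ ‖N₀‖ * p v := hNp
  refine ⟨N.mkContinuous ‖N₀‖ fun v => (hNp' v).trans ?_, fun g v => ?_, fun v hv => ?_⟩
  · have := hp v 1
    simp only [Submonoid.coe_one, map_one, one_apply_eq_self] at this
    exact mul_le_mul_of_nonneg_left this (norm_nonneg _)
  · have hpow : ∀ (n : ℕ) (v : V), ‖(ρ g ^ n) v‖ ≤ ‖v‖ := fun n v => by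
      rw [← map_pow]
      simpa using (ρ (g ^ n)).le_of_opNorm_le (hρ _) v
    -- The Cesàro mean of the first `n + 1` powers of `g` belongs to `S` and telescopes on `ρ g v -
    -- v`.
    have hle : ∀ n : ℕ, p (ρ g v - v) ≤ 2 * ‖v‖ * (1 / ((n : ℝ) + 1)) := by
      intro n
      let w : MonoidAlgebra ℂ G :=
        ((n : ℂ) + 1)⁻¹ • ∑ k ∈ Finset.range (n + 1), MonoidAlgebra.of ℂ G g ^ k
      have hw : ∀ u, π w u = ((n : ℂ) + 1)⁻¹ • ∑ k ∈ Finset.range (n + 1), (ρ g ^ k) u := by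
        intro u
        simp only [w, map_smul, map_sum, map_pow, hπ, _root_.smul_apply,
          _root_.sum_apply]
      have hn : ‖((n : ℂ) + 1)⁻¹‖ = ((n : ℝ) + 1)⁻¹ := by
        rw [norm_inv]
        congr 1
        exact_mod_cast Complex.norm_natCast (n + 1)
      have hn0 : (n : ℂ) + 1 ≠ 0 := by exact_mod_cast n.succ_ne_zero
      have hwS : w ∈ S := by
        refine ⟨fun u => ?_, fun u hu => ?_⟩
        · rw [hw, norm_smul, hn, inv_mul_le_iff₀ (by positivity)]
          refine (norm_sum_le_of_le _ fun k _ => hpow k u).trans_eq ?_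
          simp
        · have : ∀ k : ℕ, (ρ g ^ k) u = u := fun k => by rw [← map_pow]; exact hu _
          rw [hw]
          simp only [this, Finset.sum_const, Finset.card_range]
          rw [← Nat.cast_smul_eq_nsmul ℂ, smul_smul]
          push_cast
          rw [inv_mul_cancel₀ hn0, one_smul]
      refine (hp _ ⟨w, hwS⟩).trans ?_
      have : ∀ k : ℕ, (ρ g ^ k) (ρ g v - v) = (ρ g ^ (k + 1)) v - (ρ g ^ k) v := fun k => by
        rw [map_sub, pow_succ]; rfl
      simp only [hw, this]
      rw [Finset.sum_range_sub (fun k => (ρ g ^ k) v), norm_smul, hn]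
      have h2 : ‖(ρ g ^ (n + 1)) v - (ρ g ^ 0) v‖ ≤ 2 * ‖v‖ := by
        refine (norm_sub_le _ _).trans ?_
        linarith [hpow (n + 1) v, hpow 0 v]
      rw [mul_comm, one_div]
      gcongr
    have hp0 : p (ρ g v - v) ≤ 0 := by
      have := (tendsto_one_div_add_atTop_nhds_zero_nat (𝕜 := ℝ)).const_mul (2 * ‖v‖)
      rw [mul_zero] at this
      exact ge_of_tendsto' this hle
    have : ‖N (ρ g v - v)‖ ≤ 0 := (hNp' _).trans
      (mul_nonpos_of_nonneg_of_nonpos (norm_nonneg _) hp0)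
    rw [norm_le_zero_iff, map_sub, sub_eq_zero] at this
    exact this
  · exact hN ⟨v, hv⟩

end InvariantFunctional

/-- A commutative unital C⋆-algebra has a virtual diagonal. -/
theorem exists_virtualDiagonal_of_commCStarAlgebra (C : Type*) [CommCStarAlgebra C] :
    ∃ Q, IsVirtualDiagonal (ContinuousLinearMap.mul ℂ C) Q := by
  let V := C →L[ℂ] C →L[ℂ] ℂ
  let m := ContinuousLinearMap.mul ℂ C
  let ρ : unitary C →* (V →L[ℂ] V) :=
    { toFun := fun g => precompAction m (g : C) ∘L rightAction m (star (g : C))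
      map_one' := by
        ext β x y
        change β ((1 : C) * x) (y * star (1 : C)) = β x y
        simp
      map_mul' := fun g h => by
        ext β x y
        change β ((g : C) * h * x) (y * star ((g : C) * h)) =
          β (h * (g * x)) (y * star (g : C) * star (h : C))
        rw [star_mul, mul_comm (star (h : C)), mul_assoc y, mul_comm (g : C) h, mul_assoc (h : C)] }
  have hρ : ∀ g β x y, ρ g β x y = β (g * x) (y * star (g : C)) := fun g β x y => rfl
  -- The functional made invariant is evaluation at `(1, 1)`. The forms `l (x y a)` are fixed by the
  -- action since `g x y g⋆ = x y`, so their value `l a` is preserved.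
  obtain ⟨N, hN₁, hN₂⟩ := exists_invariant_functional ρ
    (fun g => ContinuousLinearMap.opNorm_le_bound _ zero_le_one fun β => by
      rw [one_mul]
      refine ContinuousLinearMap.opNorm_le_bound₂ _ (norm_nonneg _) fun x y => ?_
      rw [hρ]
      refine (β.le_opNorm₂ _ _).trans_eq ?_
      rw [CStarRing.norm_coe_unitary_mul, ← Unitary.coe_star, CStarRing.norm_mul_coe_unitary])
    ((ContinuousLinearMap.apply ℂ ℂ (1 : C)) ∘L (ContinuousLinearMap.apply ℂ (C →L[ℂ] ℂ) (1 : C)))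
  -- Unitaries span the algebra, and for a unitary `a` balance is the invariance of `N` at the form
  -- `β (x, y a)`.
  refine ⟨N, .of_total (s := unitary C) ?_ (fun a ha β => ?_) (fun a _ l => ?_)⟩
  · rw [CStarAlgebra.span_unitary]; exact dense_univ
  · rw [← hN₁ ⟨a, ha⟩ (rightAction m a β)]
    congr 1
    ext x y
    change β (a * x) y = β (a * x) (y * star a * a)
    rw [mul_assoc, Unitary.star_mul_self_of_mem ha, mul_one]
  · rw [hN₂]
    · change l (1 * 1 * a) = l a
      rw [one_mul, one_mul]
    · intro g
      ext x y
      have : (g : C) * x * (y * star (g : C)) = x * y := by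
        calc (g : C) * x * (y * star (g : C)) = x * y * (star (g : C) * g) := by ring
          _ = x * y := by rw [Unitary.coe_star_mul_self, mul_one]
      change l ((g : C) * x * (y * star (g : C)) * a) = l (x * y * a)
      rw [this]

/-! ## The second dual of an algebra of bounded continuous functions -/

section BidualCStar

universe u

open scoped BoundedContinuousFunction InnerProductSpace ComplexConjugate

variable {Y : Type*} [TopologicalSpace Y]

theorem norm_one_boundedContinuousFunction_le : ‖(1 : Y →ᵇ ℂ)‖ ≤ 1 :=
  (BoundedContinuousFunction.norm_le zero_le_one).2 fun y => by simp

/-- The functional `x ↦ conj (l (star x))`. -/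
def starFunctional (l : StrongDual ℂ (Y →ᵇ ℂ)) : StrongDual ℂ (Y →ᵇ ℂ) :=
  LinearMap.mkContinuous
    { toFun := fun x => conj (l (star x))
      map_add' := fun x y => by simp
      map_smul' := fun c x => by simp } ‖l‖ fun x => by
    simpa using l.le_opNorm (star x)

@[simp] theorem starFunctional_apply (l : StrongDual ℂ (Y →ᵇ ℂ)) (x : Y →ᵇ ℂ) :
    starFunctional l x = conj (l (star x)) := rfl

theorem norm_starFunctional_le (l : StrongDual ℂ (Y →ᵇ ℂ)) : ‖starFunctional l‖ ≤ ‖l‖ :=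
  LinearMap.mkContinuous_norm_le _ (norm_nonneg _) _

/-- Every functional of norm one is dominated by a state, its absolute value. -/
theorem exists_dominating_state (l : StrongDual ℂ (Y →ᵇ ℂ)) (hl : ‖l‖ = 1) :
    ∃ μ : StrongDual ℂ (Y →ᵇ ℂ), ‖μ‖ ≤ 1 ∧ (∀ x, μ (star x) = conj (μ x)) ∧
      (∀ x, 0 ≤ (μ (star x * x)).re) ∧
      ∀ x y, ‖l (x * y)‖ ^ 2 ≤ (μ (star x * x)).re * (μ (star y * y)).re := by
  obtain ⟨U, hU, hUl⟩ := exists_dual_vector ℂ l (fun h => by simp [h] at hl)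
  -- `U` norms `l` and plays the role of the conjugate phase in a polar decomposition: `ν = U · l`
  -- satisfies `ν 1 = 1` and `‖ν‖ ≤ 1`, and stands for the absolute value of `l`.
  let ν : StrongDual ℂ (Y →ᵇ ℂ) := U ∘L bilinAdjoint (ContinuousLinearMap.mul ℂ (Y →ᵇ ℂ)) l
  have hν : ∀ x, ‖ν x‖ ≤ ‖bilinAdjoint (ContinuousLinearMap.mul ℂ (Y →ᵇ ℂ)) l x‖ := fun x =>
    (U.le_opNorm _).trans_eq (by rw [hU, one_mul]; rfl)
  have hν1 : ν 1 = 1 := by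
    have : bilinAdjoint (ContinuousLinearMap.mul ℂ (Y →ᵇ ℂ)) l 1 = l := by
      ext y; simp [bilinAdjoint_apply]
    change U (bilinAdjoint (ContinuousLinearMap.mul ℂ (Y →ᵇ ℂ)) l 1) = 1
    rw [this, hUl, hl]
    simp
  have hl' : ∀ x, ‖l x‖ ≤ ‖x‖ := fun x => by simpa [hl] using l.le_opNorm x
  have hνn : ∀ x, ‖ν x‖ ≤ ‖x‖ := fun x =>
    (hν x).trans <| ContinuousLinearMap.opNorm_le_bound _ (norm_nonneg _) fun y =>
      (hl' _).trans (norm_mul_le x y)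
  -- If `|z| ≤ f ≤ 1` and `‖y‖ ≤ 1`, then `(1 - f) y + c z` has norm at most one for `|c| ≤ 1`.
  -- Hence the functional `l ((1 - f) ·)` has norm at most `1 - ‖l z‖`, which bounds `‖1 - ν f‖`.
  have small : ∀ (z f : Y →ᵇ ℂ) (r : Y → ℝ), (∀ t, f t = r t) → (∀ t, ‖z t‖ ≤ r t) →
      (∀ t, r t ≤ 1) → ‖l z‖ ≤ (ν f).re := by
    intro z f r hf hz hr
    have h₁ : ‖ν (1 - f)‖ ≤ 1 - ‖l z‖ := by
      refine (hν _).trans (ContinuousLinearMap.opNorm_le_of_unit_norm ?_ fun y hy => ?_)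
      · have : ‖z‖ ≤ 1 := (BoundedContinuousFunction.norm_le zero_le_one).2 fun t =>
          (hz t).trans (hr t)
        linarith [hl' z]
      rw [bilinAdjoint_apply, ContinuousLinearMap.mul_apply']
      -- The scalar `c` aligns the phase of `l z` with that of `l ((1 - f) y)`; zero values need a
      -- separate choice.
      obtain ⟨c, hc, hcl⟩ : ∃ c : ℂ, ‖c‖ ≤ 1 ∧ ‖l ((1 - f) * y) + c * l z‖ =
          ‖l ((1 - f) * y)‖ + ‖l z‖ := by
        rcases eq_or_ne (l z) 0 with h | h
        · exact ⟨0, by simp, by simp [h]⟩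
        rcases eq_or_ne (l ((1 - f) * y)) 0 with h' | h'
        · exact ⟨1, by simp, by simp [h']⟩
        set a := l ((1 - f) * y)
        set b := l z
        have hb : (‖b‖ : ℂ) ≠ 0 := by simpa using h
        have ha : (‖a‖ : ℂ) ≠ 0 := by simpa using h'
        refine ⟨a / ‖a‖ * (‖b‖ / b), ?_, ?_⟩
        · simp [norm_ne_zero_iff.2 h, norm_ne_zero_iff.2 h']
        · have : a + a / ‖a‖ * (‖b‖ / b) * b = a / ‖a‖ * ((‖a‖ + ‖b‖ : ℝ) : ℂ) := by
            push_cast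
            field_simp
          rw [this, norm_mul, norm_div, Complex.norm_real, Complex.norm_real, norm_norm,
            div_self (norm_ne_zero_iff.2 h'), one_mul, Real.norm_of_nonneg (by positivity)]
      have h₂ : ‖(1 - f) * y + c • z‖ ≤ 1 := by
        refine (BoundedContinuousFunction.norm_le zero_le_one).2 fun t => ?_
        have hy' : ‖y t‖ ≤ 1 := (y.norm_coe_le_norm t).trans hy.le
        have e : ‖1 - f t‖ = 1 - r t := by
          rw [hf, ← Complex.ofReal_one, ← Complex.ofReal_sub, Complex.norm_real,
            Real.norm_of_nonneg (sub_nonneg.2 (hr t))]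
        have h1r := sub_nonneg.2 (hr t)
        calc ‖((1 - f) * y + c • z) t‖ = ‖(1 - f t) * y t + c * z t‖ := by simp
          _ ≤ ‖1 - f t‖ * ‖y t‖ + ‖c‖ * ‖z t‖ := by
            rw [← norm_mul, ← norm_mul]; exact norm_add_le _ _
          _ ≤ (1 - r t) * 1 + 1 * r t := by
            rw [e]
            gcongr
            exact hz t
          _ = 1 := by ring
      have h₃ := (hl' _).trans h₂
      rw [map_add, map_smul, smul_eq_mul, hcl] at h₃
      linarith
    rw [map_sub, hν1] at h₁
    have := (Complex.re_le_norm _).trans h₁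
    rw [Complex.sub_re, Complex.one_re] at this
    linarith
  have main : ∀ (z f : Y →ᵇ ℂ) (r : Y → ℝ), (∀ t, f t = r t) → (∀ t, ‖z t‖ ≤ r t) →
      ‖l z‖ ≤ (ν f).re := by
    intro z f r hf hz
    -- Scaling by `s` brings `f` below `1`; the added `1` covers `f = 0`.
    set s : ℝ := (‖f‖ + 1)⁻¹ with hs
    have hs0 : 0 < s := by positivity
    have := small ((s : ℂ) • z) ((s : ℂ) • f) (fun t => s * r t) (fun t => by simp [hf])
      (fun t => by
        simp only [BoundedContinuousFunction.coe_smul, norm_smul, Complex.norm_real,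
          Real.norm_of_nonneg hs0.le]
        exact mul_le_mul_of_nonneg_left (hz t) hs0.le)
      (fun t => by
        rw [hs, inv_mul_le_iff₀ (by positivity), mul_one]
        have : ‖f t‖ = r t := by
          rw [hf, Complex.norm_real, Real.norm_of_nonneg ((norm_nonneg _).trans (hz t))]
        linarith [f.norm_coe_le_norm t])
    rw [map_smul, map_smul, norm_smul, Complex.norm_real, Real.norm_of_nonneg hs0.le,
      smul_eq_mul, Complex.re_ofReal_mul] at this
    exact le_of_mul_le_mul_left this hs0
  -- The hermitian part of `ν`, which has the same real part on the elements `star x * x`.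
  let μ : StrongDual ℂ (Y →ᵇ ℂ) := (1 / 2 : ℂ) • (ν + starFunctional ν)
  have hμ : ∀ x, μ x = (1 / 2 : ℂ) * (ν x + conj (ν (star x))) := fun x => rfl
  have hμre : ∀ x, (μ (star x * x)).re = (ν (star x * x)).re := by
    intro x
    rw [hμ, star_mul, star_star, ← Complex.ofReal_one, ← Complex.ofReal_ofNat,
      ← Complex.ofReal_div, Complex.re_ofReal_mul, Complex.add_re, Complex.conj_re]
    ring
  have hsq : ∀ (x : Y →ᵇ ℂ) t, (star x * x) t = ((‖x t‖ ^ 2 : ℝ) : ℂ) := fun x t => by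
    simp [Complex.conj_mul']
  have hpos : ∀ x, 0 ≤ (ν (star x * x)).re := fun x =>
    (norm_nonneg (l 0)).trans (main 0 _ (fun t => ‖x t‖ ^ 2) (hsq x) fun t => by simp)
  refine ⟨μ, ?_, fun x => ?_, fun x => ?_, fun x y => ?_⟩
  · refine ContinuousLinearMap.opNorm_le_bound _ zero_le_one fun x => ?_
    rw [hμ, norm_mul]
    have h₁ := norm_add_le (ν x) (conj (ν (star x)))
    have h₂ := hνn (star x)
    rw [norm_star] at h₂
    rw [Complex.norm_conj] at h₁
    have h₃ : ‖(1 / 2 : ℂ)‖ = 1 / 2 := by norm_num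
    rw [h₃]
    linarith [hνn x]
  · rw [hμ, hμ, star_star]
    simp only [map_mul, map_add, Complex.conj_conj, map_div₀, map_one, map_ofNat]
    ring
  · rw [hμre]; exact hpos x
  · rw [hμre, hμre]
    set a := (ν (star x * x)).re with ha
    set b := (ν (star y * y)).re with hb
    have ha0 : 0 ≤ a := hpos x
    have hb0 : 0 ≤ b := hpos y
    -- Pointwise `2 |t| |x y| ≤ t² |x|² + |y|²`, so `main` gives a quadratic in `t` without sign
    -- change; its discriminant is the Cauchy–Schwarz inequality sought.
    have key : ∀ t : ℝ, 0 ≤ a * (t * t) + (-(2 * ‖l (x * y)‖)) * t + b := by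
      intro t
      have := main (((2 * t : ℝ) : ℂ) • (x * y))
        (((t ^ 2 : ℝ) : ℂ) • (star x * x) + star y * y)
        (fun s => t ^ 2 * ‖x s‖ ^ 2 + ‖y s‖ ^ 2)
        (fun s => by
          rw [BoundedContinuousFunction.add_apply, BoundedContinuousFunction.smul_apply, hsq, hsq,
            smul_eq_mul]
          push_cast
          ring)
        (fun s => by
          rw [BoundedContinuousFunction.smul_apply, norm_smul, BoundedContinuousFunction.mul_apply,
            norm_mul, Complex.norm_real, Real.norm_eq_abs, abs_mul, abs_two]
          nlinarith [sq_nonneg (|t| * ‖x s‖ - ‖y s‖), sq_abs t])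
      rw [map_smul, norm_smul, Complex.norm_real, Real.norm_eq_abs, map_add, map_smul,
        Complex.add_re, smul_eq_mul, Complex.re_ofReal_mul, ← ha, ← hb, abs_mul, abs_two] at this
      nlinarith [le_abs_self t, norm_nonneg (l (x * y)),
        mul_nonneg (norm_nonneg (l (x * y))) (sub_nonneg.2 (le_abs_self t))]
    have := discrim_le_zero key
    rw [discrim] at this
    nlinarith

/-- The vector space underlying an algebra, without its norm. -/
def BareSpace (V : Type*) : Type _ := V

instance (V : Type*) [AddCommGroup V] : AddCommGroup (BareSpace V) :=
  inferInstanceAs (AddCommGroup V)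

instance (V : Type*) [AddCommGroup V] [Module ℂ V] : Module ℂ (BareSpace V) :=
  inferInstanceAs (Module ℂ V)

/-- A positive functional gives a Hilbert space completion of the algebra. -/
theorem exists_hilbert_completion {Y : Type u} [TopologicalSpace Y]
    (μ : StrongDual ℂ (Y →ᵇ ℂ)) (hμ : ∀ x, μ (star x) = conj (μ x))
    (hpos : ∀ x, 0 ≤ (μ (star x * x)).re) :
    ∃ (H : Type u) (_ : NormedAddCommGroup H) (_ : InnerProductSpace ℂ H) (_ : CompleteSpace H)
      (J : (Y →ᵇ ℂ) →L[ℂ] H), DenseRange J ∧ ∀ x y, ⟪J x, J y⟫_ℂ = μ (star x * y) := by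
  let S := BareSpace (Y →ᵇ ℂ)
  let of : S → (Y →ᵇ ℂ) := fun x => x
  let core : PreInnerProductSpace.Core ℂ S :=
    { inner := fun x y => μ (star (of x) * of y)
      conj_inner_symm := fun x y => by
        rw [← hμ, star_mul, star_star]
      re_inner_nonneg := hpos
      add_left := fun x y z => by
        change μ (star (of x + of y) * of z) = _
        rw [star_add, add_mul, map_add]
      smul_left := fun x y c => by
        change μ (star (c • of x) * of y) = _
        rw [star_smul, smul_mul_assoc, map_smul]; rfl }
  let _ : SeminormedAddCommGroup S :=
    InnerProductSpace.Core.toSeminormedAddCommGroup (c := core)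
  let _ : InnerProductSpace ℂ S := InnerProductSpace.ofCore core
  have hinner : ∀ x y : S, ⟪(x : UniformSpace.Completion S), (y : UniformSpace.Completion S)⟫_ℂ =
      μ (star (of x) * of y) := fun x y =>
    UniformSpace.Completion.inner_coe x y
  let J₀ : (Y →ᵇ ℂ) →ₗ[ℂ] UniformSpace.Completion S :=
    { toFun := fun x => UniformSpace.Completion.coe' (α := S) x
      map_add' := fun x y => UniformSpace.Completion.coe_add (α := S) x y
      map_smul' := fun c x => UniformSpace.Completion.coe_smul (X := S) c x }
  have hJ : ∀ x : Y →ᵇ ℂ, ‖J₀ x‖ ≤ √‖μ‖ * ‖x‖ := fun x => by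
    refine le_of_sq_le_sq ?_ (by positivity)
    rw [mul_pow, Real.sq_sqrt (norm_nonneg _), ← inner_self_eq_norm_sq (𝕜 := ℂ)]
    refine (Complex.re_le_norm _).trans ?_
    rw [show ⟪J₀ x, J₀ x⟫_ℂ = μ (star x * x) from hinner x x]
    refine (μ.le_opNorm _).trans ?_
    rw [CStarRing.norm_star_mul_self, sq]
  exact ⟨UniformSpace.Completion S, inferInstance, inferInstance, inferInstance,
    J₀.mkContinuous _ hJ, UniformSpace.Completion.denseRange_coe (α := S), hinner⟩

/-- Hilbert spaces are reflexive. -/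
theorem exists_eq_apply_of_bidual {H : Type*} [NormedAddCommGroup H] [InnerProductSpace ℂ H]
    [CompleteSpace H] (F : Bidual H) : ∃ h : H, ∀ η : StrongDual ℂ H, F η = η h := by
  let g : StrongDual ℂ H := LinearMap.mkContinuous
    { toFun := fun h => conj (F (InnerProductSpace.toDual ℂ H h))
      map_add' := fun x y => by simp
      map_smul' := fun c x => by
        rw [map_smulₛₗ, map_smul, smul_eq_mul, map_mul, Complex.conj_conj]; rfl } ‖F‖ fun h => by
    simpa using F.le_opNorm (InnerProductSpace.toDual ℂ H h)
  have hg : ∀ h, g h = conj (F (InnerProductSpace.toDual ℂ H h)) := fun h => rfl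
  refine ⟨(InnerProductSpace.toDual ℂ H).symm g, fun η => ?_⟩
  obtain ⟨h, rfl⟩ := (InnerProductSpace.toDual ℂ H).surjective η
  rw [InnerProductSpace.toDual_apply_apply, ← inner_conj_symm,
    InnerProductSpace.toDual_symm_apply, hg, Complex.conj_conj]

end BidualCStar

/-! ### The second dual of the bounded continuous functions as a commutative C⋆-algebra. -/

section BidualAlgebra

open scoped BoundedContinuousFunction InnerProductSpace ComplexConjugate

universe u

/-- The map `Φ ↦ Φ̂` from the second dual of an algebra to a Hilbert space. -/
theorem exists_bidual_vector {E H : Type*} [NormedAddCommGroup E] [NormedSpace ℂ E]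
    [NormedAddCommGroup H] [InnerProductSpace ℂ H] [CompleteSpace H] (J : E →L[ℂ] H)
    (Φ : Bidual E) : ∃ h : H, ∀ η : StrongDual ℂ H, Φ (η ∘L J) = η h :=
  exists_eq_apply_of_bidual (Φ ∘L (ContinuousLinearMap.compL ℂ E H ℂ).flip J)

variable {Y : Type u} [TopologicalSpace Y]

/-- For a functional `l` of norm one, the form `(x, y) ↦ l (x * y)` factors through a Hilbert
space. -/
theorem exists_hilbert_factorization (l : StrongDual ℂ (Y →ᵇ ℂ)) (hl : ‖l‖ = 1) :
    ∃ (H : Type u) (_ : NormedAddCommGroup H) (_ : InnerProductSpace ℂ H) (_ : CompleteSpace H)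
      (J : (Y →ᵇ ℂ) →L[ℂ] H) (b : H →L[ℂ] H →L[ℂ] ℂ) (μ : StrongDual ℂ (Y →ᵇ ℂ)),
      ‖μ‖ ≤ 1 ∧ (∀ x y, ⟪J x, J y⟫_ℂ = μ (star x * y)) ∧
      (∀ x y, b (J x) (J y) = l (x * y)) ∧ ∀ s t, ‖b s t‖ ≤ ‖s‖ * ‖t‖ := by
  obtain ⟨μ, hμ₁, hμ, hpos, hle⟩ := exists_dominating_state l hl
  obtain ⟨H, i₁, i₂, i₃, J, hJ, hin⟩ := exists_hilbert_completion μ hμ hpos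
  have hn : ∀ x, (μ (star x * x)).re = ‖J x‖ ^ 2 := fun x => by
    rw [← hin, ← inner_self_eq_norm_sq (𝕜 := ℂ)]; rfl
  obtain ⟨b, hb, hbn⟩ := exists_bilinear_extension_of_dense (e₁ := J.toLinearMap)
    (e₂ := J.toLinearMap) hJ hJ
    (ContinuousLinearMap.toLinearMap₁₂ (bilinAdjoint (ContinuousLinearMap.mul ℂ (Y →ᵇ ℂ)) l)) 1
    zero_le_one (fun x y => by
      have := hle x y
      rw [hn, hn, ← mul_pow] at this
      rw [one_mul]
      exact le_of_sq_le_sq this (by positivity))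
  exact ⟨H, i₁, i₂, i₃, J, b, μ, hμ₁, hin, hb, fun s t => by simpa using hbn s t⟩

/-- The second dual of the algebra of bounded continuous functions is commutative. -/
theorem bidualMul_comm (Φ Ψ : Bidual (Y →ᵇ ℂ)) :
    bidualMul (Y →ᵇ ℂ) Φ Ψ = bidualMul (Y →ᵇ ℂ) Ψ Φ := by
  have key : ∀ l : StrongDual ℂ (Y →ᵇ ℂ), ‖l‖ = 1 →
      bidualMul (Y →ᵇ ℂ) Φ Ψ l = bidualMul (Y →ᵇ ℂ) Ψ Φ l := by
    intro l hl
    obtain ⟨H, _, _, _, J, b, -, -, -, hb, -⟩ := exists_hilbert_factorization l hl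
    obtain ⟨h, hh⟩ := exists_bidual_vector J Φ
    obtain ⟨k, hk⟩ := exists_bidual_vector J Ψ
    -- By reflexivity `Φ` and `Ψ` act through vectors `h` and `k`, so both orders of evaluating the
    -- form `l (x y)` produce `b h k`.
    have e₁ : bidualMul (Y →ᵇ ℂ) Φ Ψ l = b h k := by
      rw [← ContinuousLinearMap.flip_apply b, ← hh]
      refine congrArg Φ ?_
      ext x
      refine Eq.trans (congrArg Ψ ?_) (hk (b (J x)))
      ext y
      exact (hb x y).symm
    have e₂ : bidualMul (Y →ᵇ ℂ) Ψ Φ l = b h k := by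
      rw [← hk]
      refine congrArg Ψ ?_
      ext x
      refine Eq.trans (congrArg Φ ?_) (hh (b.flip (J x)))
      ext y
      exact (congrArg l (mul_comm x y)).trans (hb y x).symm
    rw [e₁, e₂]
  ext l
  rcases eq_or_ne l 0 with rfl | hl
  · simp
  have h := key ((‖l‖ : ℂ)⁻¹ • l) (by simp [norm_smul, norm_ne_zero_iff.2 hl])
  rw [map_smul, map_smul] at h
  exact smul_right_injective ℂ (inv_ne_zero (by simpa using hl)) h

/-- The involution `Φ* l = conj (Φ (l*))` of the second dual. -/
def starBidual (Φ : Bidual (Y →ᵇ ℂ)) : Bidual (Y →ᵇ ℂ) :=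
  LinearMap.mkContinuous
    { toFun := fun l => conj (Φ (starFunctional l))
      map_add' := fun l k => by
        rw [← map_add, ← map_add]
        congr 2
        ext x
        simp
      map_smul' := fun c l => by
        have : starFunctional (c • l) = conj c • starFunctional l := by ext x; simp
        rw [this, map_smul]
        simp } ‖Φ‖ fun l => by
    simpa using (Φ.le_opNorm (starFunctional l)).trans
      (mul_le_mul_of_nonneg_left (norm_starFunctional_le l) (norm_nonneg _))

@[simp] theorem starBidual_apply (Φ : Bidual (Y →ᵇ ℂ)) (l : StrongDual ℂ (Y →ᵇ ℂ)) :
    starBidual Φ l = conj (Φ (starFunctional l)) := rfl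

/-- No order is reversed, because the involution of the commutative base algebra is multiplicative;
the Arens product unfolds with conjugates cancelling in pairs. -/
theorem starBidual_mul (Φ Ψ : Bidual (Y →ᵇ ℂ)) :
    starBidual (bidualMul (Y →ᵇ ℂ) Φ Ψ) =
      bidualMul (Y →ᵇ ℂ) (starBidual Φ) (starBidual Ψ) := by
  ext l
  refine congrArg (fun z => conj (Φ z)) ?_
  ext x
  refine Eq.trans ?_ (Complex.conj_conj _).symm
  refine congrArg Ψ ?_
  ext y
  refine congrArg (fun z => conj (l z)) ?_
  exact star_mul' x y

theorem starBidual_starBidual (Φ : Bidual (Y →ᵇ ℂ)) : starBidual (starBidual Φ) = Φ := by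
  ext l
  rw [starBidual_apply, starBidual_apply, Complex.conj_conj]
  congr 1
  ext x
  simp

theorem starBidual_add (Φ Ψ : Bidual (Y →ᵇ ℂ)) :
    starBidual (Φ + Ψ) = starBidual Φ + starBidual Ψ := by
  ext l
  simp

theorem starBidual_smul (c : ℂ) (Φ : Bidual (Y →ᵇ ℂ)) :
    starBidual (c • Φ) = conj c • starBidual Φ := by
  ext l
  simp

theorem bidualMul_inclusion_one (Φ : Bidual (Y →ᵇ ℂ)) :
    bidualMul (Y →ᵇ ℂ) (NormedSpace.inclusionInDoubleDual ℂ _ 1) Φ = Φ := by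
  ext l
  refine congrArg Φ ?_
  ext y
  exact congrArg l (one_mul y)

/-- For `l` of norm one, let `μ` be the dominating functional and `h` the vector representing `Φ` in
its Hilbert space. Then `Φ l = b (J 1) h` has modulus at most `‖h‖`, while `‖h‖²` is the value of
`Φ⋆ □ Φ` at `μ`, and `‖μ‖ ≤ 1`. -/
theorem norm_sq_le_norm_starBidual_mul (Φ : Bidual (Y →ᵇ ℂ)) :
    ‖Φ‖ * ‖Φ‖ ≤ ‖bidualMul (Y →ᵇ ℂ) (starBidual Φ) Φ‖ := by
  set s := ‖bidualMul (Y →ᵇ ℂ) (starBidual Φ) Φ‖ with hs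
  have key : ∀ l : StrongDual ℂ (Y →ᵇ ℂ), ‖l‖ = 1 → ‖Φ l‖ ≤ √s := by
    intro l hl
    obtain ⟨H, _, _, _, J, b, μ, hμ, hin, hb, hbn⟩ := exists_hilbert_factorization l hl
    obtain ⟨h, hh⟩ := exists_bidual_vector J Φ
    have e₁ : Φ l = b (J 1) h := by
      rw [← hh]
      refine congrArg Φ ?_
      ext y
      rw [ContinuousLinearMap.comp_apply, hb, one_mul]
    have hJ : ‖J 1‖ ≤ 1 := by
      rw [← abs_norm, ← sq_le_one_iff_abs_le_one, ← inner_self_eq_norm_sq (𝕜 := ℂ), hin]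
      refine (Complex.re_le_norm _).trans ((μ.le_opNorm _).trans ?_)
      rw [star_one, one_mul]
      exact mul_le_one₀ hμ (norm_nonneg _) norm_one_boundedContinuousFunction_le
    have e₂ : bidualMul (Y →ᵇ ℂ) (starBidual Φ) Φ μ = ⟪h, h⟫_ℂ := by
      rw [← inner_conj_symm, ← innerSL_apply_apply ℂ, ← hh]
      refine congrArg (fun z => conj (Φ z)) ?_
      ext x
      rw [ContinuousLinearMap.comp_apply, innerSL_apply_apply, ← inner_conj_symm,
        ← innerSL_apply_apply ℂ, ← hh]
      refine congrArg (fun z => conj (Φ z)) ?_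
      ext y
      rw [ContinuousLinearMap.comp_apply, innerSL_apply_apply, hin]
      rfl
    have hhs : ‖h‖ ≤ √s := by
      refine Real.le_sqrt_of_sq_le ?_
      rw [← inner_self_eq_norm_sq (𝕜 := ℂ), ← e₂]
      refine (Complex.re_le_norm _).trans ((ContinuousLinearMap.le_opNorm _ _).trans ?_)
      exact mul_le_of_le_one_right (norm_nonneg _) hμ
    rw [e₁]
    refine (hbn _ _).trans ?_
    calc ‖J 1‖ * ‖h‖ ≤ 1 * √s := by gcongr
      _ = √s := one_mul _
  have := ContinuousLinearMap.opNorm_le_of_unit_norm (Real.sqrt_nonneg s) key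
  calc ‖Φ‖ * ‖Φ‖ ≤ √s * √s := by gcongr
    _ = s := Real.mul_self_sqrt (norm_nonneg _)

theorem norm_bidualMul_le {A : Type*} [NonUnitalNormedRing A] [NormedSpace ℂ A]
    [IsScalarTower ℂ A A] [SMulCommClass ℂ A A] (Φ Ψ : Bidual A) :
    ‖bidualMul A Φ Ψ‖ ≤ ‖Φ‖ * ‖Ψ‖ := by
  refine ContinuousLinearMap.opNorm_le_bound _ (by positivity) fun l => ?_
  refine (Φ.le_opNorm _).trans ?_
  rw [mul_assoc]
  refine mul_le_mul_of_nonneg_left ?_ (norm_nonneg _)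
  refine ContinuousLinearMap.opNorm_le_bound _ (by positivity) fun x => ?_
  refine (Ψ.le_opNorm _).trans ?_
  rw [mul_assoc]
  refine mul_le_mul_of_nonneg_left ?_ (norm_nonneg _)
  refine ContinuousLinearMap.opNorm_le_bound _ (by positivity) fun y => ?_
  refine (l.le_opNorm _).trans ?_
  rw [mul_assoc]
  exact mul_le_mul_of_nonneg_left (norm_mul_le x y) (norm_nonneg _)

variable (Y) in
/-- The second dual of the algebra of bounded continuous functions on `Y`, as an algebra. -/
def BidualAlgebra : Type u := Bidual (Y →ᵇ ℂ)

namespace BidualAlgebra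

instance : NormedAddCommGroup (BidualAlgebra Y) :=
  inferInstanceAs (NormedAddCommGroup (Bidual (Y →ᵇ ℂ)))

instance : NormedSpace ℂ (BidualAlgebra Y) :=
  inferInstanceAs (NormedSpace ℂ (Bidual (Y →ᵇ ℂ)))

instance : CompleteSpace (BidualAlgebra Y) :=
  inferInstanceAs (CompleteSpace (Bidual (Y →ᵇ ℂ)))

instance : Mul (BidualAlgebra Y) := ⟨fun Φ Ψ => bidualMul (Y →ᵇ ℂ) Φ Ψ⟩

instance : One (BidualAlgebra Y) := ⟨NormedSpace.inclusionInDoubleDual ℂ _ 1⟩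

instance : Star (BidualAlgebra Y) := ⟨starBidual⟩

theorem mul_def (Φ Ψ : BidualAlgebra Y) : Φ * Ψ = bidualMul (Y →ᵇ ℂ) Φ Ψ := rfl

instance : CommRing (BidualAlgebra Y) :=
  { (inferInstance : AddCommGroup (BidualAlgebra Y)) with
    mul_assoc := bidualMul_assoc (Y →ᵇ ℂ)
    mul_comm := bidualMul_comm
    one_mul := bidualMul_inclusion_one
    mul_one := fun Φ => (bidualMul_comm Φ _).trans (bidualMul_inclusion_one Φ)
    left_distrib := fun Φ Ψ Ω => map_add (bidualMul (Y →ᵇ ℂ) Φ) Ψ Ω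
    right_distrib := fun Φ Ψ Ω => ContinuousLinearMap.map_add₂ (bidualMul (Y →ᵇ ℂ)) Φ Ψ Ω
    zero_mul := fun Φ => ContinuousLinearMap.map_zero₂ (bidualMul (Y →ᵇ ℂ)) Φ
    mul_zero := fun Φ => map_zero (bidualMul (Y →ᵇ ℂ) Φ) }

instance : NormedCommRing (BidualAlgebra Y) :=
  { (inferInstance : NormedAddCommGroup (BidualAlgebra Y)),
    (inferInstance : CommRing (BidualAlgebra Y)) with
    norm_mul_le := norm_bidualMul_le }

instance : NormedAlgebra ℂ (BidualAlgebra Y) where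
  __ := Algebra.ofModule (R := ℂ) (A := BidualAlgebra Y)
    (fun c Φ Ψ => ContinuousLinearMap.map_smul₂ (bidualMul (Y →ᵇ ℂ)) c Φ Ψ)
    (fun c Φ Ψ => map_smul (bidualMul (Y →ᵇ ℂ) Φ) c Ψ)
  norm_smul_le := norm_smul_le

instance : StarRing (BidualAlgebra Y) where
  star_involutive := starBidual_starBidual
  star_mul Φ Ψ := (starBidual_mul Φ Ψ).trans (bidualMul_comm _ _)
  star_add := starBidual_add

instance : CStarRing (BidualAlgebra Y) := ⟨norm_sq_le_norm_starBidual_mul⟩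

instance : StarModule ℂ (BidualAlgebra Y) := ⟨starBidual_smul⟩

instance : CommCStarAlgebra (BidualAlgebra Y) where

end BidualAlgebra

/-- The C⋆-structure lives on the synonym `BidualAlgebra Y`; its virtual diagonal is carried over by
the identity map. -/
theorem exists_virtualDiagonal_bidual :
    ∃ Q, IsVirtualDiagonal (bidualMul (Y →ᵇ ℂ)) Q := by
  obtain ⟨Q, hQ⟩ := exists_virtualDiagonal_of_commCStarAlgebra (BidualAlgebra Y)
  let θ : BidualAlgebra Y →ₗ[ℂ] Bidual (Y →ᵇ ℂ) :=
    { toFun := fun Φ => Φ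
      map_add' := fun _ _ => rfl
      map_smul' := fun _ _ => rfl }
  exact hQ.map (mS := bidualMul (Y →ᵇ ℂ)) (θ.mkContinuous 1 fun Φ => (one_mul ‖Φ‖).ge)
    (fun _ _ => rfl) (Function.surjective_id.denseRange)

/-- The characters of the second dual of the algebra of bounded continuous functions are
norming. -/
theorem norm_bidual_le_of_characters (Φ : Bidual (Y →ᵇ ℂ)) (c : ℝ) (hc : 0 ≤ c)
    (h : ∀ χ : StrongDual ℂ (Bidual (Y →ᵇ ℂ)), ‖χ‖ ≤ 1 →
      (∀ Ψ Ω, χ (bidualMul (Y →ᵇ ℂ) Ψ Ω) = χ Ψ * χ Ω) → ‖χ Φ‖ ≤ c) : ‖Φ‖ ≤ c := by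
  let a : BidualAlgebra Y := Φ
  -- The Gelfand transform of a commutative unital C⋆-algebra is isometric, so the norm is the
  -- supremum over characters.
  have e : ‖WeakDual.gelfandTransform ℂ (BidualAlgebra Y) a‖ = ‖a‖ :=
    (AddMonoidHomClass.isometry_iff_norm _).1 (gelfandTransform_isometry (BidualAlgebra Y)) a
  change ‖a‖ ≤ c
  rw [← e, ContinuousMap.norm_le _ hc]
  intro χ
  refine h (WeakDual.toStrongDual χ.1) ?_ (map_mul χ)
  refine (WeakDual.CharacterSpace.norm_le_norm_one χ).trans ?_
  exact (NormedSpace.double_dual_bound ℂ _ _).trans norm_one_boundedContinuousFunction_le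

end BidualAlgebra

/-! ## Sufficient conditions for amenability -/

section Sufficiency

open scoped BoundedContinuousFunction

/-! ### Second adjoints, and multiplications for the injective norm. -/

section BidualMap

variable {E F : Type*} [NormedAddCommGroup E] [NormedSpace ℂ E]
  [NormedAddCommGroup F] [NormedSpace ℂ F]

/-- The second adjoint of a bounded linear map. -/
def bidualMap (θ : E →L[ℂ] F) : Bidual E →L[ℂ] Bidual F :=
  (ContinuousLinearMap.compL ℂ (StrongDual ℂ F) (StrongDual ℂ E) ℂ).flip
    ((ContinuousLinearMap.compL ℂ E F ℂ).flip θ)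

theorem bidualMap_apply (θ : E →L[ℂ] F) (Φ : Bidual E) (l : StrongDual ℂ F) :
    bidualMap θ Φ l = Φ (l ∘L θ) := rfl

theorem bidualMap_mul {A B : Type*} [NonUnitalNormedRing A] [NormedSpace ℂ A]
    [IsScalarTower ℂ A A] [SMulCommClass ℂ A A] [NonUnitalNormedRing B] [NormedSpace ℂ B]
    [IsScalarTower ℂ B B] [SMulCommClass ℂ B B] {θ : A →L[ℂ] B}
    (hθ : ∀ a b, θ (a * b) = θ a * θ b) (Φ Ψ : Bidual A) :
    bidualMap θ (bidualMul A Φ Ψ) = bidualMul B (bidualMap θ Φ) (bidualMap θ Ψ) := by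
  ext l
  refine congrArg Φ ?_
  ext x
  refine congrArg Ψ ?_
  ext y
  exact congrArg l (hθ x y)

/-- The slice map `id ⊗ ψ`. -/
def rightSlice (E : Type*) [NormedAddCommGroup E] [NormedSpace ℂ E] (ψ : StrongDual ℂ F) :
    E ⊗[ℂ] F →ₗ[ℂ] E :=
  TensorProduct.lift ((LinearMap.lsmul ℂ E).comp ψ.toLinearMap).flip

theorem apply_rightSlice (φ : StrongDual ℂ E) (ψ : StrongDual ℂ F) (u : E ⊗[ℂ] F) :
    φ (rightSlice E ψ u) = tensorForm E F u φ ψ := by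
  induction u using TensorProduct.induction_on with
  | zero => simp
  | add u v hu hv => simp [hu, hv]
  | tmul x y => simp [tensorForm_tmul, rightSlice, mul_comm]

/-- Slicing at a character is multiplicative. -/
theorem leftSlice_algTensorMul {mE : E →L[ℂ] E →L[ℂ] E} {mF : F →L[ℂ] F →L[ℂ] F}
    {χ : StrongDual ℂ E} (hχ : ∀ a b, χ (mE a b) = χ a * χ b) (u v : E ⊗[ℂ] F) :
    leftSlice F χ (algTensorMul mE mF u v) = mF (leftSlice F χ u) (leftSlice F χ v) := by
  induction u using TensorProduct.induction_on with
  | zero => simp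
  | add u u' hu hu' => simp [hu, hu']
  | tmul x y =>
    induction v using TensorProduct.induction_on with
    | zero => simp
    | add v v' hv hv' => simp [hv, hv']
    | tmul x' y' => simp [hχ, smul_smul, mul_comm]

/-- If the characters of the first algebra are norming up to constants, then the injective norm is
submultiplicative up to a constant. -/
theorem exists_isTensorMul_injNorm {mE : E →L[ℂ] E →L[ℂ] E} (mF : F →L[ℂ] F →L[ℂ] F) (K k : ℝ)
    (hK : 0 ≤ K)
    (h : ∀ a c, 0 ≤ c → (∀ χ : StrongDual ℂ E, ‖χ‖ ≤ k → (∀ a b, χ (mE a b) = χ a * χ b) →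
      ‖χ a‖ ≤ c) → ‖a‖ ≤ K * c) :
    ∃ m, IsTensorMul (injNorm E F) mE mF m := by
  refine exists_isTensorMul (K * (‖mF‖ * k ^ 2)) (by positivity) fun u v => ?_
  have hu := apply_nonneg (injNorm E F) u
  have hv := apply_nonneg (injNorm E F) v
  refine injNorm_le (by positivity) fun φ ψ => ?_
  -- Slicing by `ψ` leaves an element of `E`, which is tested on characters `χ`. There the order of
  -- slicing is exchanged: `χ ⊗ id` is multiplicative, so only the product of two slices in `F` has
  -- to be bounded. Each slice costs a factor `k`.
  have key : ‖rightSlice E ψ (algTensorMul mE mF u v)‖ ≤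
      K * (‖mF‖ * k ^ 2 * injNorm E F u * injNorm E F v * ‖ψ‖) := by
    refine h _ _ (by positivity) fun χ hχn hχ => ?_
    rw [apply_rightSlice, ← apply_leftSlice, leftSlice_algTensorMul hχ]
    have hk : 0 ≤ k := (norm_nonneg _).trans hχn
    calc ‖ψ (mF (leftSlice F χ u) (leftSlice F χ v))‖
        ≤ ‖ψ‖ * (‖mF‖ * ‖leftSlice F χ u‖ * ‖leftSlice F χ v‖) :=
          ψ.le_opNorm_of_le (mF.le_opNorm₂ _ _)
      _ ≤ ‖ψ‖ * (‖mF‖ * (k * injNorm E F u) * (k * injNorm E F v)) := by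
          gcongr
          · exact (norm_leftSlice_le χ u).trans (mul_le_mul_of_nonneg_right hχn hu)
          · exact (norm_leftSlice_le χ v).trans (mul_le_mul_of_nonneg_right hχn hv)
      _ = _ := by ring
  rw [← apply_rightSlice]
  refine (φ.le_opNorm_of_le key).trans_eq (by ring)

end BidualMap

variable {Y : Type*} [TopologicalSpace Y]
  {B : Type*} [NonUnitalNormedRing B] [NormedSpace ℂ B] [IsScalarTower ℂ B B] [SMulCommClass ℂ B B]
  {A : Type*} [NonUnitalNormedRing A] [NormedSpace ℂ A] [IsScalarTower ℂ A A] [SMulCommClass ℂ A A]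

/-- If `B` is isomorphic to an algebra of bounded continuous functions, then amenability of `A**`
implies that of both tensor products of `B**` and `A**`. -/
theorem amenable_tensors_of_equiv (θ : (Y →ᵇ ℂ) →L[ℂ] B) (θ' : B →L[ℂ] (Y →ᵇ ℂ))
    (hθ : ∀ f g, θ (f * g) = θ f * θ g) (hθ' : ∀ f g, θ' (f * g) = θ' f * θ' g)
    (hθθ' : ∀ f, θ (θ' f) = f) (hA : IsAmenable (bidualMul A)) :
    InjTensorBidualAmenable B A ∧ ProjTensorBidualAmenable B A := by
  have hid : ∀ Φ, bidualMap θ (bidualMap θ' Φ) = Φ := fun Φ => by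
    ext l
    refine congrArg Φ ?_
    ext x
    exact congrArg l (hθθ' x)
  obtain ⟨M, hM⟩ := hA.exists_virtualDiagonal (bidualMul_assoc A)
  obtain ⟨N₀, hN₀⟩ := exists_virtualDiagonal_bidual (Y := Y)
  obtain ⟨N, hN⟩ := hN₀.map (mS := bidualMul B) (bidualMap θ) (bidualMap_mul hθ)
    (Function.Surjective.denseRange fun Φ => ⟨_, hid Φ⟩)
  constructor
  · obtain ⟨m, hm⟩ := exists_isTensorMul_injNorm (mE := bidualMul B) (bidualMul A)
      ‖bidualMap θ‖ ‖bidualMap θ'‖ (norm_nonneg _) fun Φ c hc h => by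
        rw [← hid Φ]
        refine (bidualMap θ).le_opNorm_of_le (norm_bidual_le_of_characters _ c hc ?_)
        intro χ hχ₁ hχ
        -- Characters of the second dual of the function algebra pull back along the second adjoint
        -- of `θ'`, at the cost of a factor `‖bidualMap θ'‖` in the norm.
        refine h (χ ∘L bidualMap θ') ?_ fun Ψ Ω => ?_
        · exact (ContinuousLinearMap.opNorm_comp_le _ _).trans
            (mul_le_of_le_one_left (norm_nonneg _) hχ₁)
        · simp only [ContinuousLinearMap.comp_apply]
          rw [bidualMap_mul hθ', hχ]
    obtain ⟨Q, hQ⟩ := hN.tensor hM injNorm_tmul_le hm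
    exact ⟨m, hm, hQ.isAmenable (hm.assoc (bidualMul_assoc B) (bidualMul_assoc A))⟩
  · obtain ⟨m, hm⟩ := exists_isTensorMul_projNorm (bidualMul B) (bidualMul A)
    obtain ⟨Q, hQ⟩ := hN.tensor hM projNorm_tmul_le hm
    exact ⟨m, hm, hQ.isAmenable (hm.assoc (bidualMul_assoc B) (bidualMul_assoc A))⟩

/-- The range of a function, with the discrete topology. -/
def DiscreteRange {X D : Type*} (ev : X → D) : Type _ := Set.range ev

instance {X D : Type*} (ev : X → D) : TopologicalSpace (DiscreteRange ev) := ⊥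

instance {X D : Type*} (ev : X → D) : DiscreteTopology (DiscreteRange ev) := ⟨rfl⟩

/-- If every bounded function on `X` that factors through the characters `ev x` is represented by
an element of `B`, with control of the norm, then amenability of `A**` implies that of both tensor
products of `B**` and `A**`. -/
theorem amenable_tensors_of_full {X : Type*} (ev : X → StrongDual ℂ B)
    (hev : ∀ x f g, ev x (f * g) = ev x f * ev x g) (hn : ∀ x, ‖ev x‖ ≤ 1)
    (hinj : ∀ f g, (∀ x, ev x f = ev x g) → f = g) (K : ℝ)
    (hfull : ∀ (g : X → ℂ) (M : ℝ), 0 ≤ M → (∀ x, ‖g x‖ ≤ M) →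
      (∀ x y, ev x = ev y → g x = g y) → ∃ f, (∀ x, ev x f = g x) ∧ ‖f‖ ≤ K * M)
    (hA : IsAmenable (bidualMul A)) :
    InjTensorBidualAmenable B A ∧ ProjTensorBidualAmenable B A := by
  -- Functions are indexed by the characters `ev x` rather than by points, since points may fail to
  -- be separated.
  let mk (x : X) : DiscreteRange ev := ⟨ev x, x, rfl⟩
  have hbound : ∀ (y : DiscreteRange ev) f, ‖y.1 f‖ ≤ ‖f‖ := by
    rintro ⟨_, x, rfl⟩ f
    simpa using (ev x).le_of_opNorm_le (hn x) f
  let eval (f : B) : DiscreteRange ev →ᵇ ℂ :=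
    BoundedContinuousFunction.ofNormedAddCommGroup (fun y => y.1 f) continuous_of_discreteTopology
      ‖f‖ fun y => hbound y f
  let θ' : B →L[ℂ] (DiscreteRange ev →ᵇ ℂ) := LinearMap.mkContinuous
    { toFun := eval
      map_add' := fun f g => by ext y; exact map_add y.1 f g
      map_smul' := fun c f => by ext y; exact map_smul y.1 c f } 1 fun f => by
    rw [one_mul]
    exact (BoundedContinuousFunction.norm_le (norm_nonneg _)).2 fun y => hbound y f
  have hθ'x : ∀ f x, θ' f (mk x) = ev x f := fun f x => rfl
  -- The chosen representative is unique by `hinj`, which makes `r` linear and multiplicative.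
  choose r hr hrn using fun g : DiscreteRange ev →ᵇ ℂ =>
    hfull (fun x => g (mk x)) ‖g‖ (norm_nonneg _) (fun x => g.norm_coe_le_norm _)
      (fun x y hxy => congrArg g (Subtype.ext hxy))
  let θ : (DiscreteRange ev →ᵇ ℂ) →L[ℂ] B := LinearMap.mkContinuous
    { toFun := r
      map_add' := fun f g => hinj _ _ fun x => by simp [hr]
      map_smul' := fun c f => hinj _ _ fun x => by simp [hr] } K hrn
  have hθx : ∀ g x, ev x (θ g) = g (mk x) := hr
  refine amenable_tensors_of_equiv θ θ' (fun f g => ?_) (fun f g => ?_) (fun f => ?_) hA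
  · refine hinj _ _ fun x => ?_
    rw [hev, hθx, hθx, hθx, BoundedContinuousFunction.mul_apply]
  · ext ⟨_, x, rfl⟩
    exact hev x f g
  · refine hinj _ _ fun x => ?_
    rw [hθx, hθ'x]

end Sufficiency

/-! ## Lipschitz algebras -/

section LipschitzAlgebras

variable {X : Type*} [MetricSpace X]

namespace Lip

theorem norm_apply_le (f : Lip X) (x : X) : ‖f x‖ ≤ ‖f‖ :=
  (norm_le_supNorm f x).trans (le_add_of_nonneg_right (lipConst_nonneg f))

theorem norm_sub_le (f : Lip X) (x y : X) : ‖f x - f y‖ ≤ ‖f‖ * dist x y :=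
  (norm_sub_le_lipConst f x y).trans
    (mul_le_mul_of_nonneg_right (le_add_of_nonneg_left (supNorm_nonneg f)) dist_nonneg)

/-- Evaluation at a point. -/
def eval (x : X) : StrongDual ℂ (Lip X) :=
  LinearMap.mkContinuous
    { toFun := fun f => f x
      map_add' := fun _ _ => rfl
      map_smul' := fun _ _ => rfl } 1 fun f => (norm_apply_le f x).trans_eq (one_mul _).symm

@[simp] theorem eval_apply (x : X) (f : Lip X) : eval x f = f x := rfl

theorem norm_eval_le (x : X) : ‖eval x‖ ≤ 1 := LinearMap.mkContinuous_norm_le _ zero_le_one _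

theorem norm_eval_sub_le (x y : X) : ‖eval x - eval y‖ ≤ dist x y :=
  ContinuousLinearMap.opNorm_le_bound _ dist_nonneg fun f => by
    rw [mul_comm]; exact norm_sub_le f x y

/-- A bounded function that is constant on the sets of diameter less than `δ` is Lipschitz. -/
theorem exists_of_bounded {δ : ℝ} (hδ : 0 < δ) {g : X → ℂ} {M : ℝ} (hM : 0 ≤ M)
    (hg : ∀ x, ‖g x‖ ≤ M) (h : ∀ x y, dist x y < δ → g x = g y) :
    ∃ f : Lip X, (∀ x, f x = g x) ∧ ‖f‖ ≤ (1 + 2 / δ) * M := by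
  have hl : ∀ x y, ‖g x - g y‖ ≤ 2 / δ * M * dist x y := by
    intro x y
    -- Close points have equal values; for the others the difference is at most `2 M`, and `δ ≤ dist
    -- x y` turns this into the constant `2 / δ * M`.
    rcases lt_or_ge (dist x y) δ with hxy | hxy
    · rw [h x y hxy, sub_self, norm_zero]
      positivity
    · calc ‖g x - g y‖ ≤ M + M := (_root_.norm_sub_le _ _).trans (add_le_add (hg x) (hg y))
        _ = 2 / δ * M * δ := by field_simp; ring
        _ ≤ 2 / δ * M * dist x y := by gcongr
  let f : Lip X := ⟨g, ⟨M, hg⟩, ⟨_, hl⟩⟩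
  refine ⟨f, fun _ => rfl, ?_⟩
  rw [norm_def, add_mul, one_mul]
  exact add_le_add (supNorm_le hM hg) (lipConst_le (by positivity) hl)

/-- `Lip(X)` separates the points of `X`. -/
theorem separates {x y : X} (hxy : x ≠ y) : ∃ f : Lip X, f x ≠ f y := by
  let g (z : X) : ℝ := min (dist z x) 1
  have hg0 : ∀ z, 0 ≤ g z := fun z => le_min dist_nonneg zero_le_one
  refine ⟨⟨fun z => (g z : ℂ), ⟨1, fun z => ?_⟩, ⟨1, fun z w => ?_⟩⟩, fun h => ?_⟩
  · rw [Complex.norm_real, Real.norm_of_nonneg (hg0 z)]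
    exact min_le_right _ _
  · rw [← Complex.ofReal_sub, Complex.norm_real, one_mul, Real.norm_eq_abs]
    refine (abs_min_sub_min_le_max _ _ _ _).trans ?_
    rw [sub_self, abs_zero]
    exact max_le (abs_dist_sub_le z w x) dist_nonneg
  · have h' : g x = g y := Complex.ofReal_injective h
    have hx : g x = 0 := by simp [g]
    have hy : 0 < g y := lt_min (dist_pos.2 hxy.symm) one_pos
    linarith

end Lip

/-- Evaluation at a point of little Lipschitz functions. -/
def littleLipEval (x : X) : StrongDual ℂ (littleLip X) :=
  LinearMap.mkContinuous
    { toFun := fun f => (f : Lip X) x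
      map_add' := fun _ _ => rfl
      map_smul' := fun _ _ => rfl } 1 fun f => 
        (Lip.norm_apply_le (f : Lip X) x).trans_eq (one_mul _).symm

@[simp] theorem littleLipEval_apply (x : X) (f : littleLip X) :
    littleLipEval x f = (f : Lip X) x := rfl

/-! ### Amenability criteria for `Lip(X)` and `lip(X)`. -/

variable {A : Type*} [NonUnitalNormedRing A] [NormedSpace ℂ A] [IsScalarTower ℂ A A]
  [SMulCommClass ℂ A A]

theorem Lip.necessary [Nonempty X] {p : Seminorm ℂ (Bidual (Lip X) ⊗[ℂ] Bidual A)}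
    (hp : ∀ u, injNorm (Bidual (Lip X)) (Bidual A) u ≤ p u)
    (h : IsAmenableTensor p (bidualMul (Lip X)) (bidualMul A))
    (hA : (WeakDual.characterSpace ℂ A).Nonempty) :
    UniformlyDiscrete X ∧ IsAmenable (bidualMul A) := by
  obtain ⟨h₁, δ, hδ, h₂⟩ := h.necessary hp hA Lip.eval (fun _ _ _ => rfl)
    (fun x hx => one_ne_zero (DFunLike.congr_fun hx (1 : Lip X))) Lip.norm_eval_le
    Lip.norm_eval_sub_le
  -- Halving turns the bound `δ ≤ dist x y` into the strict inequality of the definition.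
  refine ⟨⟨δ / 2, by positivity, fun x y hxy => ?_⟩, h₁⟩
  obtain ⟨f, hf⟩ := Lip.separates hxy
  have := h₂ x y fun e => hf (DFunLike.congr_fun e f)
  linarith

/-- On a uniformly discrete space every bounded function is Lipschitz, so `Lip(X)` is the algebra of
all bounded functions up to an equivalent norm. -/
theorem Lip.sufficient (hX : UniformlyDiscrete X) (hA : IsAmenable (bidualMul A)) :
    InjTensorBidualAmenable (Lip X) A ∧ ProjTensorBidualAmenable (Lip X) A := by
  obtain ⟨δ, hδ, h⟩ := hX
  refine amenable_tensors_of_full Lip.eval (fun _ _ _ => rfl) Lip.norm_eval_le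
    (fun f g hfg => Lip.ext hfg) (1 + 2 / δ) (fun g M hM hg _ => ?_) hA
  refine Lip.exists_of_bounded hδ hM hg fun x y hxy => ?_
  by_contra hne
  exact hxy.not_gt (h x y fun e => hne (congrArg g e))

variable (X) in
/-- Points that are separated by little Lipschitz functions are uniformly apart. -/
def LittleLipDiscrete : Prop :=
  ∃ δ : ℝ, 0 < δ ∧ ∀ x y : X, (∃ f ∈ littleLip X, f x ≠ f y) → δ ≤ dist x y

theorem UniformlyDiscrete.littleLipDiscrete (hX : UniformlyDiscrete X) : LittleLipDiscrete X := by
  obtain ⟨δ, hδ, h⟩ := hX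
  exact ⟨δ, hδ, fun x y ⟨f, _, hf⟩ => (h x y fun e => hf (congrArg (f : X → ℂ) e)).le⟩

theorem LittleLipDiscrete.uniformlyDiscrete (hX : LittleLipDiscrete X)
    (hs : LittleLipSeparates X) : UniformlyDiscrete X := by
  obtain ⟨δ, hδ, h⟩ := hX
  exact ⟨δ / 2, by positivity, fun x y hxy => (half_lt_self hδ).trans_le (h x y (hs x y hxy))⟩

/-- The lower bound on distances is obtained only where evaluations differ on `lip(X)`, which is why
the conclusion is weaker than uniform discreteness. -/
theorem littleLip_necessary [Nonempty X] {p : Seminorm ℂ (Bidual (littleLip X) ⊗[ℂ] Bidual A)}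
    (hp : ∀ u, injNorm (Bidual (littleLip X)) (Bidual A) u ≤ p u)
    (h : IsAmenableTensor p (bidualMul (littleLip X)) (bidualMul A))
    (hA : (WeakDual.characterSpace ℂ A).Nonempty) :
    LittleLipDiscrete X ∧ IsAmenable (bidualMul A) := by
  obtain ⟨h₁, δ, hδ, h₂⟩ := h.necessary hp hA littleLipEval (fun _ _ _ => rfl)
    (fun x hx => one_ne_zero (DFunLike.congr_fun hx (1 : littleLip X)))
    (fun x => LinearMap.mkContinuous_norm_le _ zero_le_one _)
    (fun x y => ContinuousLinearMap.opNorm_le_bound _ dist_nonneg fun f => by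
      rw [mul_comm]; exact Lip.norm_sub_le (f : Lip X) x y)
  refine ⟨⟨δ, hδ, fun x y hxy => ?_⟩, h₁⟩
  obtain ⟨f, hfl, hf⟩ := hxy
  exact h₂ x y fun e => hf (DFunLike.congr_fun e (⟨f, hfl⟩ : littleLip X))

/-- Points closer than `δ` are not separated by `lip(X)`. A bounded function that respects this has
vanishing differences at scales below `δ`, so it is Lipschitz and little Lipschitz; thus `lip(X)` is
the algebra of bounded functions on the classes of unseparated points. -/
theorem littleLip_sufficient (hX : LittleLipDiscrete X) (hA : IsAmenable (bidualMul A)) :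
    InjTensorBidualAmenable (littleLip X) A ∧ ProjTensorBidualAmenable (littleLip X) A := by
  obtain ⟨δ, hδ, h⟩ := hX
  refine amenable_tensors_of_full littleLipEval (fun _ _ _ => rfl)
    (fun x => LinearMap.mkContinuous_norm_le _ zero_le_one _)
    (fun f g hfg => Subtype.ext (Lip.ext hfg)) (1 + 2 / δ) (fun g M hM hg hc => ?_) hA
  have hc' : ∀ x y, dist x y < δ → g x = g y := fun x y hxy => by
    refine hc x y ?_
    ext f
    by_contra hne
    exact hxy.not_ge (h x y ⟨f, f.2, hne⟩)
  obtain ⟨f, hf, hfn⟩ := Lip.exists_of_bounded hδ hM hg hc'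
  refine ⟨⟨f, fun ε hε => ⟨δ, hδ, fun x y _ hxy => ?_⟩⟩, hf, hfn⟩
  rw [hf, hf, hc' x y hxy, sub_self, norm_zero, zero_div]
  exact hε.le

end LipschitzAlgebras

end LipTensor

end
-- The equivalences.
theorem theorem2p8 {X : Type*} [MetricSpace X] [Nonempty X]
    {A : Type*} [NonUnitalNormedRing A] [NormedSpace ℂ A] [IsScalarTower ℂ A A]
    [SMulCommClass ℂ A A] [CompleteSpace A]
    (hA : (WeakDual.characterSpace ℂ A).Nonempty) :
    [LipTensor.InjTensorBidualAmenable (LipTensor.Lip X) A,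
      LipTensor.ProjTensorBidualAmenable (LipTensor.Lip X) A,
      LipTensor.UniformlyDiscrete X ∧ LipTensor.IsAmenable (LipTensor.bidualMul A)].TFAE ∧
    (LipTensor.LittleLipSeparates X →
      [LipTensor.InjTensorBidualAmenable (LipTensor.littleLip X) A,
        LipTensor.ProjTensorBidualAmenable (LipTensor.littleLip X) A,
        LipTensor.UniformlyDiscrete X ∧ LipTensor.IsAmenable (LipTensor.bidualMul A)].TFAE) ∧
    (LipTensor.InjTensorBidualAmenable (LipTensor.littleLip X) A ↔
      LipTensor.ProjTensorBidualAmenable (LipTensor.littleLip X) A) ∧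
    (LipTensor.InjTensorBidualAmenable (LipTensor.littleLip X) A →
      LipTensor.IsAmenable (LipTensor.bidualMul A)) ∧
    (LipTensor.UniformlyDiscrete X ∧ LipTensor.IsAmenable (LipTensor.bidualMul A) →
      LipTensor.InjTensorBidualAmenable (LipTensor.littleLip X) A) := by
  open LipTensor in
  have lip₁ : InjTensorBidualAmenable (Lip X) A → UniformlyDiscrete X ∧ IsAmenable (bidualMul A) :=
    fun h => Lip.necessary (fun _ => le_rfl) h hA
  open LipTensor in
  have lip₂ : ProjTensorBidualAmenable (Lip X) A → UniformlyDiscrete X ∧ IsAmenable (bidualMul A) :=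
    fun h => Lip.necessary injNorm_le_projNorm h hA
  open LipTensor in
  have little₁ : InjTensorBidualAmenable (littleLip X) A →
      LittleLipDiscrete X ∧ IsAmenable (bidualMul A) :=
    fun h => littleLip_necessary (fun _ => le_rfl) h hA
  open LipTensor in
  have little₂ : ProjTensorBidualAmenable (littleLip X) A →
      LittleLipDiscrete X ∧ IsAmenable (bidualMul A) :=
    fun h => littleLip_necessary injNorm_le_projNorm h hA
  refine ⟨?_, fun hs => ?_, ?_, fun h => (little₁ h).2,
    fun h => (LipTensor.littleLip_sufficient h.1.littleLipDiscrete h.2).1⟩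
  · tfae_have 1 → 3 := lip₁
    tfae_have 2 → 3 := lip₂
    tfae_have 3 → 1 := fun h => (LipTensor.Lip.sufficient h.1 h.2).1
    tfae_have 3 → 2 := fun h => (LipTensor.Lip.sufficient h.1 h.2).2
    tfae_finish
  · tfae_have 1 → 3 := fun h => ⟨(little₁ h).1.uniformlyDiscrete hs, (little₁ h).2⟩
    tfae_have 2 → 3 := fun h => ⟨(little₂ h).1.uniformlyDiscrete hs, (little₂ h).2⟩
    tfae_have 3 → 1 := fun h => (LipTensor.littleLip_sufficient h.1.littleLipDiscrete h.2).1
    tfae_have 3 → 2 := fun h => (LipTensor.littleLip_sufficient h.1.littleLipDiscrete h.2).2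
    tfae_finish
  -- Without separation both tensor products are compared through `LittleLipDiscrete X` together
  -- with amenability of `A**`.
  · exact ⟨fun h => (LipTensor.littleLip_sufficient (little₁ h).1 (little₁ h).2).2,
      fun h => (LipTensor.littleLip_sufficient (little₂ h).1 (little₂ h).2).1⟩
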